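/- Let $d\ge 2$. For $u>0$ put $h^1(x,u)=\chi_{[-u/2,u/2)}(x)$ and $h^r(x,u)=\int_{\mathbb R}h^{r-1}(x-y,u)\,h^1(y,u)\,dy$ for $r\ge 2$. For $\mathbf z\in[0,1)^d$, $\mathbf u\in(0,1/2]^d$ put $h^r(\mathbf x,\mathbf z,\mathbf u)=\prod_{j=1}^d h^r(x_j-z_j,u_j)$, and let $\tilde h^r(\mathbf x,\mathbf z,\mathbf u)=\sum_{\mathbf k\in\mathbb Z^d}h^r(\mathbf x+\mathbf k,\mathbf z,\mathbf u)$ be its periodization. For a finite family $\xi=\{\xi^\mu\}_{\mu=1}^m$ of points of $[0,1)^d$ and $v>0$ define $$\tilde D^{r,o}(\xi,v)=\inf_{\lambda_1,\dots,\lambda_m\in\mathbb R}\ \sup_{\substack{\mathbf z\in[0,1)^d,\ \mathbf u\in(0,1/2]^d\\ u_1\cdots u_d=v}}\left|\int_{[0,1)^d}\tilde h^r(\mathbf x,\mathbf z,\mathbf u)\,d\mathbf x-\sum_{\mu=1}^m\lambda_\mu\tilde h^r(\xi^\mu,\mathbf z,\mathbf u)\right|$$ (a supremum over the empty set being $0$),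 and let $\tilde D^{r,o}(\xi)$ be the same quantity with the supremum over all $\mathbf z\in[0,1)^d$ and $\mathbf u\in(0,1/2]^d$. Call a real $d\times d$ matrix $A$ a Frolov matrix if $1^0$) $\left|\prod_{j=1}^d (A\mathbf m)_j\right|\ge 1$ for all $\mathbf m\in\mathbb Z^d\setminus\{\mathbf 0\}$, and $2^0$) every axis-parallel box $P$ of volume $|P|$ contains at most $|P|+1$ points of the lattice $A\mathbb Z^d$. For a Frolov matrix $A$ and $a>1$ let $\eta=\{\eta^\mu\}_{\mu=1}^m$ be the set of the points $(A^{-1})^T\mathbf m/a$, $\mathbf m\in\mathbb Z^d$, lying in $[-1/2,3/2)^d$, and let $\xi=\xi(a,A)=\{\xi^\mu\}_{\mu=1}^m$, where $\xi^\mu$ is the vector of the fractional parts of the coordinates of $\eta^\mu$ (the folded Frolov point set, $m=m(a,A)$). Frolov matrices exist for every $d\ge2$. For every Frolov matrix $A$ and every integer $r\ge 2$ the following holds. (i) There are constants $c=c(d,A,r)>0$ and $C=C(d,A,r)>0$ such that for all $a>1$ and all $v\ge v_0:=c\,a^{-d}$ $$\tilde D^{r,o}(\xi(a,A),v)\le C\,a^{-rd}\bigl(\log(2v/v_0)\bigr)^{d-1}.$$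 (ii) There is a constant $C=C(d,A,r)>0$ such that for all $a>1$ with $m=m(a,A)\ge 2$ $$\tilde D^{r,o}_m:=\tilde D^{r,o}(\xi(a,A))\le C\,m^{-r}(\log m)^{d-1}.$$ In particular, with one Frolov matrix $A$ fixed for each $d$, the constant in (ii) depends only on $d$ and $r$. -/

import Mathlib

namespace FrolovPeriodic

open MeasureTheory
open scoped ENNReal Matrix

/-- The univariate building blocks `h^r(x, u)`: `h^1(x, u)` is the indicator of `[-u/2, u/2)`, and
`h^r(x, u) = ∫ h^{r-1}(x - y, u) h^1(y, u) dy` for `r ≥ 2` (so `h^2(x, u) = max (u - |x|) 0`).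
The value at `r = 0` is a dummy. -/
noncomputable def hat : ℕ → ℝ → ℝ → ℝ
  | 0, _, _ => 0
  | 1, x, u => Set.indicator (Set.Ico (-u / 2) (u / 2)) (fun _ => (1 : ℝ)) x
  | (r + 2), x, u =>
      ∫ y : ℝ, hat (r + 1) (x - y) u * Set.indicator (Set.Ico (-u / 2) (u / 2)) (fun _ => (1 : ℝ)) y

/-- The multivariate function `h^r(x, z, u) = ∏ⱼ h^r(xⱼ - zⱼ, uⱼ)`. -/
noncomputable def hatProd {d : ℕ} (r : ℕ) (x z u : Fin d → ℝ) : ℝ :=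
  ∏ j, hat r (x j - z j) (u j)

/-- The periodization `x ↦ ∑_{k ∈ ℤ^d} f(k + x)` of a compactly supported function `f` on `ℝ^d`. -/
noncomputable def periodize {d : ℕ} (f : (Fin d → ℝ) → ℝ) (x : Fin d → ℝ) : ℝ :=
  ∑' k : Fin d → ℤ, f (fun j => (k j : ℝ) + x j)

/-- The periodic functions `h̃^r(x, z, u)`. -/
noncomputable def perHat {d : ℕ} (r : ℕ) (x z u : Fin d → ℝ) : ℝ :=
  periodize (fun y => hatProd r y z u) x

/-- The unit cube `[0, 1)^d`. -/
def unitCube (d : ℕ) : Set (Fin d → ℝ) := {x | ∀ j, x j ∈ Set.Ico (0 : ℝ) 1}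

/-- The set `(0, 1/2]^d` of admissible scale vectors `u`. -/
def scales (d : ℕ) : Set (Fin d → ℝ) := {u | ∀ j, u j ∈ Set.Ioc (0 : ℝ) (1 / 2)}

/-- The error `|∫_{[0,1)^d} h̃^r(x, z, u) dx - ∑_μ λ_μ h̃^r(ξ^μ, z, u)|` of the cubature formula
with nodes `ξ^μ` and weights `λ_μ`. -/
noncomputable def cubatureError {d : ℕ} {ι : Type*} [Fintype ι] (r : ℕ) (ξ : ι → Fin d → ℝ)
    (wt : ι → ℝ) (z u : Fin d → ℝ) : ℝ :=
  |(∫ x in unitCube d, perHat r x z u) - ∑ μ, wt μ * perHat r (ξ μ) z u|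

/-- The optimized `r`-smooth fixed volume periodic discrepancy `D̃^{r,o}(ξ, v)`: the infimum over
real weights of the supremum of the error over `z ∈ [0,1)^d` and `u ∈ (0,1/2]^d` with `∏ⱼ uⱼ = v`.
It takes values in `[0, ∞]`. -/
noncomputable def fixedVolumeDiscrepancy {d : ℕ} {ι : Type*} [Fintype ι] (r : ℕ)
    (ξ : ι → Fin d → ℝ) (v : ℝ) : ℝ≥0∞ :=
  ⨅ wt : ι → ℝ, ⨆ z ∈ unitCube d, ⨆ u ∈ {u | u ∈ scales d ∧ ∏ j, u j = v},
    ENNReal.ofReal (cubatureError r ξ wt z u)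

/-- The optimized `r`-smooth periodic discrepancy of `ξ`: as above, with the supremum over all
`z ∈ [0,1)^d` and all `u ∈ (0,1/2]^d`. -/
noncomputable def periodicDiscrepancy {d : ℕ} {ι : Type*} [Fintype ι] (r : ℕ)
    (ξ : ι → Fin d → ℝ) : ℝ≥0∞ :=
  ⨅ wt : ι → ℝ, ⨆ z ∈ unitCube d, ⨆ u ∈ scales d, ENNReal.ofReal (cubatureError r ξ wt z u)

/-- The two properties of the matrix of a Frolov lattice `{A m : m ∈ ℤ^d}`. -/
structure IsFrolovMatrix {d : ℕ} (A : Matrix (Fin d) (Fin d) ℝ) : Prop where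
  /-- All nonzero integer vectors satisfy `|∏ⱼ Lⱼ(m)| ≥ 1`. -/
  one_le_abs_prod : ∀ m : Fin d → ℤ, m ≠ 0 → 1 ≤ |∏ j, (A *ᵥ fun i => (m i : ℝ)) j|
  /-- An axis-parallel box `P` contains at most `|P| + 1` lattice points. -/
  card_le : ∀ p q : Fin d → ℝ, (∀ j, p j < q j) →
    {y | y ∈ Set.Icc p q ∧ ∃ m : Fin d → ℤ, y = A *ᵥ fun i => (m i : ℝ)}.Finite ∧
    ({y | y ∈ Set.Icc p q ∧ ∃ m : Fin d → ℤ, y = A *ᵥ fun i => (m i : ℝ)}.ncard : ℝ)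
      ≤ ∏ j, (q j - p j) + 1

/-- The set `η` of the points `(A⁻¹)ᵀ m / a`, `m ∈ ℤ^d`, that lie in `[-1/2, 3/2)^d`. -/
def frolovNodes {d : ℕ} (a : ℝ) (A : Matrix (Fin d) (Fin d) ℝ) : Set (Fin d → ℝ) :=
  {x | (∃ m : Fin d → ℤ, x = a⁻¹ • ((A⁻¹)ᵀ *ᵥ fun i => (m i : ℝ))) ∧
    ∀ j, x j ∈ Set.Ico (-1 / 2 : ℝ) (3 / 2)}

theorem frolovNodes_finite {d : ℕ} (a : ℝ) (A : Matrix (Fin d) (Fin d) ℝ) :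
    (frolovNodes a A).Finite := by
  by_cases ha : a = 0
  · refine (Set.finite_singleton (0 : Fin d → ℝ)).subset ?_
    rintro x ⟨⟨m, rfl⟩, -⟩
    simp [ha]
  by_cases hA : IsUnit A.det
  · obtain ⟨K, hK⟩ : ∃ K : ℤ, ∀ i, |a| * ∑ j, |A j i| * (3 / 2) ≤ (K : ℝ) := by
      obtain ⟨B, hB⟩ := (Set.finite_range fun i => |a| * ∑ j, |A j i| * (3 / 2)).bddAbove
      exact ⟨⌈B⌉, fun i => (hB ⟨i, rfl⟩).trans (Int.le_ceil B)⟩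
    refine ((Set.finite_Icc (fun _ : Fin d => -K) (fun _ => K)).image
      fun m => a⁻¹ • ((A⁻¹)ᵀ *ᵥ fun i => (m i : ℝ))).subset ?_
    rintro x ⟨⟨m, hm⟩, hx⟩
    refine ⟨m, ?_, hm.symm⟩
    have hmx : (fun i => (m i : ℝ)) = a • (Aᵀ *ᵥ x) := by
      rw [hm, Matrix.mulVec_smul, smul_smul, mul_inv_cancel₀ ha, one_smul, Matrix.mulVec_mulVec,
        ← Matrix.transpose_mul, Matrix.nonsing_inv_mul A hA, Matrix.transpose_one,
        Matrix.one_mulVec]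
    have hb : ∀ i, |(m i : ℝ)| ≤ K := by
      intro i
      have h := congrFun hmx i
      simp only [Pi.smul_apply, smul_eq_mul, Matrix.mulVec, dotProduct,
        Matrix.transpose_apply] at h
      rw [h, abs_mul]
      refine le_trans ?_ (hK i)
      gcongr
      refine (Finset.abs_sum_le_sum_abs _ _).trans (Finset.sum_le_sum fun j _ => ?_)
      rw [abs_mul]
      gcongr
      have := hx j
      rw [abs_le]
      constructor <;> linarith [this.1, this.2]
    constructor
    · intro i
      have := (abs_le.1 (hb i)).1
      exact_mod_cast this
    · intro i
      have := (abs_le.1 (hb i)).2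
      exact_mod_cast this
  · refine (Set.finite_singleton (0 : Fin d → ℝ)).subset ?_
    rintro x ⟨⟨m, rfl⟩, -⟩
    simp [Matrix.nonsing_inv_apply_not_isUnit A hA]

noncomputable instance {d : ℕ} (a : ℝ) (A : Matrix (Fin d) (Fin d) ℝ) :
    Fintype (frolovNodes a A) := (frolovNodes_finite a A).fintype

/-- The folded Frolov points `ξ^μ = {η^μ}` (coordinatewise fractional parts), indexed by the
points `η^μ` themselves. -/
noncomputable def foldedFrolov {d : ℕ} (a : ℝ) (A : Matrix (Fin d) (Fin d) ℝ) :
    frolovNodes a A → Fin d → ℝ :=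
  fun η j => Int.fract (η.1 j)

/-- The number `m` of points in the family `ξ` (with multiplicity). -/
noncomputable def frolovCard {d : ℕ} (a : ℝ) (A : Matrix (Fin d) (Fin d) ℝ) : ℕ :=
  Fintype.card (frolovNodes a A)

end FrolovPeriodic

namespace FrolovPeriodic

open MeasureTheory
open scoped ENNReal Matrix

/-! The cubature weights can be chosen explicitly and independently of z and u, so a single error
estimate bounds both infima. Take the product over coordinates of a smooth `bump` supported in
[-1/2, 3/2] whose integer translates sum to 1. Multiplying h̃^r(·, z, u) by it preserves the
integral over a period and yields a compactly supported F. The nodes carry the weights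
`frolovWeight`; since h̃^r is periodic, folding does not change its values, and the weighted sum is
(a^d |det A|)⁻¹ times the sum of F over the whole scaled dual lattice. Poisson summation
(`tsum_dualPoint`) turns it into the sum of F̂(a A n) over integer vectors n. The term n = 0 is
exactly the integral, so the error is the sum over n ≠ 0.

Two estimates control that sum. Pairing with h^r amounts to averaging r times over windows of length
u, and each averaging of a modulated bump gains a factor min(u, 1/|y|)
(`exists_norm_iterate_windowIntegral_le`). With y = A n this gives |F̂(a y)| ≤ C a^(-rd) ∏ max(1/(a
u_j), |y_j|)^(-r). For the lattice sum (`exists_sum_lattice_le`), group the n ≠ 0 into dyadic boxes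
with sides proportional to 2^(s_j)/(a u_j). A nonempty box has volume parameter q ≥ 1 by the product
property, and contains O(q) points by the counting property, each contributing O(q^(-r)). As r ≥ 2,
the box contributes O(1/q). There are at most (N+1)^(d-1) vectors s with sum N, so the geometric
series leaves the factor log(2 a^d v)^(d-1), where v = ∏ u_j and a^d v ≥ 1. This is (i) with c = 1;
(ii) follows because m is comparable to a^d.

Frolov matrices come from a monic irreducible integer polynomial with d real roots: for the
Vandermonde matrix of the roots, the product of the coordinates of A m is a nonzero integer
resultant (`one_le_abs_prod_eval`). -/

open Polynomial in
/-- Frolov's polynomial `∏_{i<d} (X - 4i) - 1`. -/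
noncomputable def frolovPoly (d : ℕ) : ℤ[X] := ∏ i : Fin d, (X - C (4 * (i : ℤ))) - 1

/-! ### Existence of Frolov matrices -/

section FrolovPoly
open Polynomial

theorem monic_frolovPoly {d : ℕ} (hd : 1 ≤ d) :
    (frolovPoly d).Monic ∧ (frolovPoly d).natDegree = d := by
  have h1 : (∏ i : Fin d, (X - C (4 * (i : ℤ)))).Monic :=
    monic_prod_of_monic _ _ fun i _ => monic_X_sub_C _
  have h2 : (∏ i : Fin d, (X - C (4 * (i : ℤ)))).natDegree = d := by
    rw [natDegree_prod_of_monic _ _ fun i _ => monic_X_sub_C _]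
    simp only [natDegree_X_sub_C, Finset.sum_const, Finset.card_univ, Fintype.card_fin,
      smul_eq_mul, mul_one]
  have h3 : degree (1 : ℤ[X]) < degree (∏ i : Fin d, (X - C (4 * (i : ℤ)))) := by
    rw [degree_eq_natDegree h1.ne_zero, h2, degree_one]
    exact_mod_cast hd
  refine ⟨h1.sub_of_left h3, ?_⟩
  rw [frolovPoly, natDegree_sub_eq_left_of_natDegree_lt, h2]
  rw [h2, natDegree_one]; omega

theorem eval_frolovPoly {d : ℕ} (j : Fin d) : (frolovPoly d).eval (4 * (j : ℤ)) = -1 := by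
  rw [frolovPoly, eval_sub, eval_prod, Finset.prod_eq_zero (Finset.mem_univ j)] <;> simp

/-- In a monic factorization fg with both factors nonconstant, f and g take opposite values ±1 at
the d points 4j. Then f + g has d zeros and degree below d, hence vanishes, which is impossible for
two monic polynomials. -/
theorem irreducible_frolovPoly {d : ℕ} (hd : 1 ≤ d) : Irreducible (frolovPoly d) := by
  obtain ⟨hm, hdeg⟩ := monic_frolovPoly hd
  rw [hm.irreducible_iff_natDegree]
  refine ⟨fun h => by rw [h, natDegree_one] at hdeg; omega, fun f g hf hg hfg => ?_⟩
  by_contra! hne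
  have hsum : f.natDegree + g.natDegree = d := by rw [← hf.natDegree_mul hg, hfg, hdeg]
  have hz : f + g = 0 := by
    refine eq_zero_of_natDegree_lt_card_of_eval_eq_zero (f + g) (ι := Fin d)
      (f := fun j => 4 * (j : ℤ)) (fun i j h => by simpa [Fin.ext_iff] using h) (fun j => ?_) ?_
    · have h := eval_frolovPoly j
      rw [← hfg, eval_mul] at h
      rw [eval_add]
      rcases Int.mul_eq_neg_one_iff_eq_one_or_neg_one.1 h with h | h <;> rw [h.1, h.2] <;> rfl
    · rw [Fintype.card_fin]
      have := natDegree_add_le f g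
      have h1 := hne.1
      have h2 := hne.2
      omega
  have h1 : f = -g := eq_neg_of_add_eq_zero_left hz
  have h2 := hf.leadingCoeff
  rw [h1, leadingCoeff_neg, hg.leadingCoeff] at h2
  norm_num at h2

/-- At the points 4k - 2 the product has absolute value above 1, so subtracting 1 does not change
its sign. Between 4j - 2 and 4j + 2 only the j-th factor changes sign, which gives a root in each of
d disjoint intervals. -/
theorem exists_roots_frolovPoly (d : ℕ) : ∃ ξ : Fin d → ℝ, Function.Injective ξ ∧
    ∀ j, ((frolovPoly d).map (Int.castRingHom ℝ)).eval (ξ j) = 0 := by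
  set P := (frolovPoly d).map (Int.castRingHom ℝ) with hP
  have heval : ∀ x : ℝ, P.eval x = ∏ i : Fin d, (x - 4 * (i : ℝ)) - 1 := fun x => by
    simp [hP, frolovPoly, Polynomial.map_prod, eval_prod]
  have habs : ∀ (t : ℝ) (k : ℤ), t = 4 * k - 2 → Nonempty (Fin d) →
      1 < |∏ i : Fin d, (t - 4 * (i : ℝ))| := by
    intro t k ht hne
    rw [Finset.abs_prod]
    calc (1 : ℝ) < 2 ^ d := one_lt_pow₀ one_lt_two (Fin.pos_iff_nonempty.2 hne).ne'
      _ = ∏ i : Fin d, (2 : ℝ) := by simp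
      _ ≤ _ := Finset.prod_le_prod (fun _ _ => by norm_num) fun i _ => by
        rw [ht]
        have h : (2 : ℤ) ≤ |4 * k - 2 - 4 * (i : ℤ)| := by
          rcases le_or_gt k i with h | h
          · rw [abs_of_nonpos] <;> omega
          · rw [abs_of_nonneg] <;> omega
        exact_mod_cast h
  have key : ∀ j : Fin d, ∃ x ∈ Set.Ioo (4 * (j : ℝ) - 2) (4 * (j : ℝ) + 2), P.eval x = 0 := by
    intro j
    set s := ∏ i : Fin d, (4 * (j : ℝ) - 2 - 4 * (i : ℝ)) with hs
    set t := ∏ i : Fin d, (4 * (j : ℝ) + 2 - 4 * (i : ℝ)) with ht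
    have hs1 : 1 < |s| := habs _ (j : ℤ) (by push_cast; ring) ⟨j⟩
    have ht1 : 1 < |t| := habs _ ((j : ℤ) + 1) (by push_cast; ring) ⟨j⟩
    have hst : s * t < 0 := by
      -- Paired factors equal 16(j - i)² - 4, negative exactly when i = j.
      rw [hs, ht, ← Finset.prod_mul_distrib, ← Finset.mul_prod_erase _ _ (Finset.mem_univ j)]
      refine mul_neg_of_neg_of_pos (by nlinarith) (Finset.prod_pos fun i hi => ?_)
      have hij : (i : ℤ) ≠ j := by
        have := Finset.ne_of_mem_erase hi
        simpa [Fin.ext_iff] using this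
      have h : (1 : ℤ) ≤ ((j : ℤ) - i) ^ 2 := by
        have : (j : ℤ) - i ≠ 0 := sub_ne_zero.2 hij.symm
        have := sq_pos_of_ne_zero (a := (j : ℤ) - i) this
        omega
      have h' : (1 : ℝ) ≤ ((j : ℝ) - i) ^ 2 := by exact_mod_cast h
      nlinarith
    have hc : ContinuousOn (fun x => P.eval x) (Set.Icc (4 * (j : ℝ) - 2) (4 * (j : ℝ) + 2)) :=
      P.continuous.continuousOn
    have e1 : P.eval (4 * (j : ℝ) - 2) = s - 1 := heval _
    have e2 : P.eval (4 * (j : ℝ) + 2) = t - 1 := heval _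
    rcases lt_or_ge s 0 with h | h
    · have ht0 : 0 < t := by nlinarith
      rw [abs_of_pos ht0] at ht1
      obtain ⟨x, hx, h0⟩ := intermediate_value_Ioo (by linarith) hc
        (show (0 : ℝ) ∈ Set.Ioo _ _ from ⟨by simp only [e1]; linarith, by simp only [e2]; linarith⟩)
      exact ⟨x, hx, h0⟩
    · have ht0 : t < 0 := by nlinarith
      rw [abs_of_nonneg h] at hs1
      obtain ⟨x, hx, h0⟩ := intermediate_value_Ioo' (by linarith) hc
        (show (0 : ℝ) ∈ Set.Ioo _ _ from ⟨by simp only [e2]; linarith, by simp only [e1]; linarith⟩)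
      exact ⟨x, hx, h0⟩
  choose ξ hξ h0 using key
  refine ⟨ξ, fun i j hij => ?_, h0⟩
  have h1 := hξ i
  have h2 := hξ j
  rw [hij] at h1
  have ha : (i : ℝ) < j + 1 := by linarith [h1.1, h2.2]
  have hb : (j : ℝ) < i + 1 := by linarith [h2.1, h1.2]
  have ha' : (i : ℕ) < j + 1 := by exact_mod_cast ha
  have hb' : (j : ℕ) < i + 1 := by exact_mod_cast hb
  exact Fin.ext (by omega)

/-- The product of the values of q at the roots of the monic P is the resultant of P and q, an
integer. It is nonzero because P is irreducible over ℚ by Gauss's lemma and q has smaller degree, so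
the two are coprime. -/
theorem one_le_abs_prod_eval {d : ℕ} (hd : 1 ≤ d) {ξ : Fin d → ℝ} (hξ : Function.Injective ξ)
    (h0 : ∀ j, ((frolovPoly d).map (Int.castRingHom ℝ)).eval (ξ j) = 0) {q : ℤ[X]} (hq : q ≠ 0)
    (hqd : q.natDegree < d) : 1 ≤ |∏ j, (q.map (Int.castRingHom ℝ)).eval (ξ j)| := by
  obtain ⟨hm, hdeg⟩ := monic_frolovPoly hd
  set P := (frolovPoly d).map (Int.castRingHom ℝ) with hP
  have hPm : P.Monic := hm.map _
  have hPd : P.natDegree = d := by rw [hP, hm.natDegree_map, hdeg]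
  have hle : (Finset.univ.image ξ).val ≤ P.roots := by
    rw [Finset.val_le_iff_val_subset]
    intro x hx
    obtain ⟨j, -, rfl⟩ := Finset.mem_image.1 (Finset.mem_def.2 hx)
    exact (mem_roots hPm.ne_zero).2 (h0 j)
  have hroots : P.roots = Finset.univ.val.map ξ := by
    rw [← Multiset.eq_of_le_of_card_le hle, Finset.image_val_of_injOn hξ.injOn]
    rw [Finset.card_val, Finset.card_image_of_injective _ hξ, Finset.card_univ, Fintype.card_fin]
    exact (card_roots' P).trans hPd.le
  have hsplit : P.Splits := by
    rw [splits_iff_card_roots, hroots, hPd]; simp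
  have hres := resultant_eq_prod_eval P (q.map (Int.castRingHom ℝ)) q.natDegree natDegree_map_le
    hsplit
  rw [hPm.leadingCoeff, one_pow, one_mul, hroots, Multiset.map_map, hPd, hP,
    resultant_map_map] at hres
  have hcop : IsCoprime ((frolovPoly d).map (Int.castRingHom ℚ)) (q.map (Int.castRingHom ℚ)) := by
    have hirr : Irreducible ((frolovPoly d).map (Int.castRingHom ℚ)) :=
      (IsPrimitive.Int.irreducible_iff_irreducible_map_cast hm.isPrimitive).1 (irreducible_frolovPoly hd)
    refine (hirr.coprime_iff_not_dvd).2 fun hdvd => ?_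
    have hq0 : q.map (Int.castRingHom ℚ) ≠ 0 :=
      (Polynomial.map_ne_zero_iff (RingHom.injective_int _)).2 hq
    have := natDegree_le_of_dvd hdvd hq0
    rw [hm.natDegree_map, hdeg] at this
    exact absurd (this.trans natDegree_map_le) (by omega)
  have hne : resultant (frolovPoly d) q d q.natDegree ≠ 0 := by
    have h := resultant_ne_zero _ _ hcop
    rw [hm.natDegree_map, hdeg, natDegree_map_eq_of_injective (RingHom.injective_int _),
      resultant_map_map] at h
    exact fun h' => h (by rw [h', map_zero])
  have h1 : (1 : ℤ) ≤ |resultant (frolovPoly d) q d q.natDegree| := Int.one_le_abs hne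
  have h2 : ∏ j, (q.map (Int.castRingHom ℝ)).eval (ξ j) = 
      ((resultant (frolovPoly d) q d q.natDegree : ℤ) : ℝ) := by
    rw [Finset.prod_eq_multiset_prod]
    exact hres.symm
  rw [h2]
  exact_mod_cast h1

end FrolovPoly

/-- If distinct points of `S` have `∏ⱼ |yⱼ - y'ⱼ| ≥ 1`, a box of volume `V` contains at most
`V + 1` points of `S`. -/
theorem finite_ncard_le_of_separated {d : ℕ} (hd : 1 ≤ d) {S : Set (Fin d → ℝ)}
    (hS : ∀ y ∈ S, ∀ y' ∈ S, y ≠ y' → 1 ≤ |∏ j, (y j - y' j)|) (p q : Fin d → ℝ)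
    (hpq : ∀ j, p j < q j) :
    {y | y ∈ Set.Icc p q ∧ y ∈ S}.Finite ∧
      ({y | y ∈ Set.Icc p q ∧ y ∈ S}.ncard : ℝ) ≤ ∏ j, (q j - p j) + 1 := by
  set V := ∏ j, (q j - p j) with hV
  have hV0 : 0 < V := Finset.prod_pos fun j _ => sub_pos.2 (hpq j)
  -- The box is cut into N > V slabs across one coordinate. Two points of S in a common slab would
  -- have difference product at most V/N < 1, so each slab holds at most one point.
  set N := ⌊V⌋₊ + 1 with hN
  have hVN : V < N := by rw [hN]; push_cast; exact Nat.lt_floor_add_one V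
  have hN0 : (0 : ℝ) < N := hV0.trans hVN
  let o : Fin d := ⟨0, hd⟩
  set t : (Fin d → ℝ) → ℝ := fun y => N * ((y o - p o) / (q o - p o)) with ht
  -- Slabs are t ∈ (k, k+1]. Truncated subtraction also puts t = 0 into slab 0, so points of one
  -- slab satisfy |t y - t y'| ≤ 1, not strictly.
  set f : (Fin d → ℝ) → ℕ := fun y => ⌈t y⌉₊ - 1 with hf
  have hlo : 0 < q o - p o := sub_pos.2 (hpq o)
  have hmaps : ∀ y ∈ {y | y ∈ Set.Icc p q ∧ y ∈ S}, f y ∈ (Finset.range N : Set ℕ) := by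
    rintro y ⟨hy, -⟩
    have h1 : t y ≤ N := by
      have : (y o - p o) / (q o - p o) ≤ 1 := by
        rw [div_le_one hlo]; linarith [hy.2 o]
      nlinarith
    have h2 : ⌈t y⌉₊ ≤ N := Nat.ceil_le.2 h1
    simp only [Finset.coe_range, Set.mem_Iio, hf]
    omega
  have hinj : Set.InjOn f {y | y ∈ Set.Icc p q ∧ y ∈ S} := by
    rintro y ⟨hy, hyS⟩ y' ⟨hy', hyS'⟩ hff
    by_contra hne
    have h1 := hS y hyS y' hyS' hne
    have htn : ∀ y ∈ Set.Icc p q, 0 ≤ t y := fun y hy =>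
      mul_nonneg hN0.le (div_nonneg (sub_nonneg.2 (hy.1 o)) hlo.le)
    have hclose : |t y - t y'| ≤ 1 := by
      have a1 := Nat.le_ceil (t y)
      have a2 := Nat.le_ceil (t y')
      have b1 := Nat.ceil_lt_add_one (htn y hy)
      have b2 := Nat.ceil_lt_add_one (htn y' hy')
      have c1 := htn y hy
      have c2 := htn y' hy'
      simp only [hf] at hff
      have hcases : ⌈t y⌉₊ = ⌈t y'⌉₊ ∨ (⌈t y⌉₊ ≤ 1 ∧ ⌈t y'⌉₊ ≤ 1) := by omega
      rw [abs_le]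
      rcases hcases with h | ⟨h, h'⟩
      · rw [h] at a1 b1
        constructor <;> linarith
      · have e1 : (⌈t y⌉₊ : ℝ) ≤ 1 := by exact_mod_cast h
        have e2 : (⌈t y'⌉₊ : ℝ) ≤ 1 := by exact_mod_cast h'
        constructor <;> linarith
    have h0 : |y o - y' o| ≤ (q o - p o) / N := by
      have e : t y - t y' = N * ((y o - y' o) / (q o - p o)) := by
        simp only [ht]; field_simp; ring
      rw [e, abs_mul, abs_div, abs_of_pos hN0, abs_of_pos hlo, ← mul_div_assoc, div_le_one hlo] at hclose
      rw [le_div_iff₀ hN0]; linarith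
    have h2 : |∏ j, (y j - y' j)| ≤ V / N := by
      rw [Finset.abs_prod, hV, ← Finset.mul_prod_erase _ _ (Finset.mem_univ o),
        ← Finset.mul_prod_erase _ (fun j => q j - p j) (Finset.mem_univ o), mul_div_right_comm]
      refine mul_le_mul h0 (Finset.prod_le_prod (fun _ _ => abs_nonneg _) fun j _ => ?_)
        (Finset.prod_nonneg fun _ _ => abs_nonneg _) (div_nonneg hlo.le hN0.le)
      rw [abs_le]
      constructor <;> linarith [hy.1 j, hy.2 j, hy'.1 j, hy'.2 j]
    have h3 : V / N < 1 := (div_lt_one hN0).2 hVN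
    linarith
  have hfin : {y | y ∈ Set.Icc p q ∧ y ∈ S}.Finite :=
    Set.Finite.of_injOn hmaps hinj (Finset.finite_toSet _)
  refine ⟨hfin, ?_⟩
  have hcard := Set.ncard_le_ncard_of_injOn f hmaps hinj (Finset.finite_toSet _)
  rw [Set.ncard_coe_finset, Finset.card_range] at hcard
  have h4 : ({y | y ∈ Set.Icc p q ∧ y ∈ S}.ncard : ℝ) ≤ N := by exact_mod_cast hcard
  have h5 : (N : ℝ) ≤ V + 1 := by
    rw [hN]; push_cast; linarith [Nat.floor_le hV0.le]
  exact h4.trans h5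

theorem exists_isFrolovMatrix {d : ℕ} (hd : 1 ≤ d) :
    ∃ A : Matrix (Fin d) (Fin d) ℝ, IsFrolovMatrix A := by
  obtain ⟨ξ, hξ, h0⟩ := exists_roots_frolovPoly d
  -- With this Vandermonde matrix, (A m)_j is the value at the j-th root of the polynomial with
  -- coefficients m.
  let A : Matrix (Fin d) (Fin d) ℝ := Matrix.of fun i j => ξ i ^ (j : ℕ)
  have hA : ∀ m : Fin d → ℤ, m ≠ 0 → 1 ≤ |∏ j, (A *ᵥ fun i => (m i : ℝ)) j| := by
    intro m hm
    set q : Polynomial ℤ := ∑ i : Fin d, Polynomial.monomial (i : ℕ) (m i) with hq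
    have hcoeff : ∀ i : Fin d, q.coeff i = m i := by
      intro i
      simp [hq, Polynomial.coeff_monomial, Fin.val_inj]
    have hq0 : q ≠ 0 := by
      intro h
      apply hm
      funext i
      rw [← hcoeff i, h]; simp
    have hqd : q.natDegree < d := by
      refine lt_of_le_of_lt (Polynomial.natDegree_sum_le_of_forall_le (n := d - 1) _ _ fun i _ =>
        (Polynomial.natDegree_monomial_le _).trans ?_) (by omega)
      omega
    have h := one_le_abs_prod_eval hd hξ h0 hq0 hqd
    convert h using 4 with j
    simp [A, Matrix.mulVec, dotProduct, hq, Polynomial.map_sum, Polynomial.eval_finsetSum, mul_comm]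
  refine ⟨A, hA, fun p q hpq => ?_⟩
  refine finite_ncard_le_of_separated hd (S := {y | ∃ m : Fin d → ℤ, y = A *ᵥ fun i => (m i : ℝ)})
    ?_ p q hpq
  rintro _ ⟨m, rfl⟩ _ ⟨m', rfl⟩ hne
  have h := hA (m - m') (sub_ne_zero.2 fun h => hne (by rw [h]))
  convert h using 4 with j
  rw [← Pi.sub_apply, ← Matrix.mulVec_sub]
  congr 2
  funext i
  simp

/-! ### Nondegeneracy of Frolov matrices and the number of nodes -/

theorem IsFrolovMatrix.mulVec_injective {d : ℕ} (hd : 1 ≤ d) {A : Matrix (Fin d) (Fin d) ℝ}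
    (hA : IsFrolovMatrix A) :
    Function.Injective fun m : Fin d → ℤ => A *ᵥ fun i => (m i : ℝ) := by
  intro m m' h
  by_contra hne
  have h1 := hA.one_le_abs_prod (m - m') (sub_ne_zero.2 hne)
  have h2 : (A *ᵥ fun i => ((m - m') i : ℝ)) = 0 := by
    have : (fun i => ((m - m') i : ℝ)) = (fun i => (m i : ℝ)) - fun i => (m' i : ℝ) := by
      funext i; simp
    rw [this, Matrix.mulVec_sub, sub_eq_zero]
    exact h
  rw [h2, Finset.prod_eq_zero (Finset.mem_univ (⟨0, hd⟩ : Fin d)) rfl, abs_zero] at h1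
  linarith

theorem abs_mulVec_le {d : ℕ} (A : Matrix (Fin d) (Fin d) ℝ) {x : Fin d → ℝ} {K : ℝ} (hK : 0 ≤ K)
    (hx : ∀ i, |x i| ≤ K) (j : Fin d) : |(A *ᵥ x) j| ≤ (∑ i, ∑ k, |A i k|) * K := by
  calc |(A *ᵥ x) j| = |∑ k, A j k * x k| := rfl
    _ ≤ ∑ k, |A j k * x k| := Finset.abs_sum_le_sum_abs _ _
    _ ≤ ∑ k, |A j k| * K := Finset.sum_le_sum fun k _ => by
        rw [abs_mul]; exact mul_le_mul_of_nonneg_left (hx k) (abs_nonneg _)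
    _ = (∑ k, |A j k|) * K := (Finset.sum_mul _ _ _).symm
    _ ≤ _ := mul_le_mul_of_nonneg_right
        (Finset.single_le_sum (f := fun i => ∑ k, |A i k|)
          (fun i _ => Finset.sum_nonneg fun _ _ => abs_nonneg _) (Finset.mem_univ j)) hK

/-- If A v = 0 with v ≠ 0, rounding multiples of v to integer vectors gives infinitely many lattice
points within bounded distance of 0, against the finiteness in the counting property. -/
theorem IsFrolovMatrix.det_ne_zero {d : ℕ} (hd : 1 ≤ d) {A : Matrix (Fin d) (Fin d) ℝ}
    (hA : IsFrolovMatrix A) : A.det ≠ 0 := by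
  intro hdet
  obtain ⟨v, hv, hAv⟩ := Matrix.exists_mulVec_eq_zero_iff.2 hdet
  obtain ⟨j, hj⟩ := Function.ne_iff.1 hv
  simp only [Pi.zero_apply] at hj
  -- Dividing by v_j makes the j-th coordinate equal to q, so these integer vectors are distinct.
  set m : ℕ → Fin d → ℤ := fun q i => round (q * (v i / v j)) with hm
  set C := (∑ i, ∑ k, |A i k|) * (1 / 2) with hC
  have hbound : ∀ q i, |(A *ᵥ fun i => (m q i : ℝ)) i| ≤ C := by
    intro q i
    have h : (A *ᵥ fun i => (m q i : ℝ)) =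
        A *ᵥ fun i => (m q i : ℝ) - q * (v i / v j) := by
      have e : (fun i => (m q i : ℝ) - q * (v i / v j)) =
          (fun i => (m q i : ℝ)) - ((q : ℝ) / v j) • v := by
        funext i; simp only [Pi.sub_apply, Pi.smul_apply, smul_eq_mul]; ring
      rw [e, Matrix.mulVec_sub, Matrix.mulVec_smul, hAv, smul_zero, sub_zero]
    rw [h]
    refine abs_mulVec_le A (by norm_num) (fun i => ?_) i
    rw [abs_sub_comm]
    exact abs_sub_round _
  have hfin := (hA.card_le (fun _ => -(C + 1)) (fun _ => C + 1) (fun j => by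
    have : 0 ≤ C := mul_nonneg (Finset.sum_nonneg fun _ _ => Finset.sum_nonneg fun _ _ =>
      abs_nonneg _) (by norm_num)
    linarith)).1
  refine hfin.not_infinite (Set.infinite_of_injective_forall_mem (f := fun q : ℕ =>
    A *ᵥ fun i => (m q i : ℝ)) ?_ fun q => ⟨⟨fun i => ?_, fun i => ?_⟩, m q, rfl⟩)
  · intro q q' h
    have h1 := congrFun (hA.mulVec_injective hd h) j
    simpa [hm, div_self hj] using h1
  · linarith [(abs_le.1 (hbound q i)).1]
  · linarith [(abs_le.1 (hbound q i)).2]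

/-- The points `(A⁻¹)ᵀ m / a` of the scaled dual lattice. -/
noncomputable def dualPoint {d : ℕ} (a : ℝ) (A : Matrix (Fin d) (Fin d) ℝ) (m : Fin d → ℤ) :
    Fin d → ℝ := a⁻¹ • ((A⁻¹)ᵀ *ᵥ fun i => (m i : ℝ))

theorem smul_transpose_mulVec_dualPoint {d : ℕ} {a : ℝ} (ha : a ≠ 0)
    {A : Matrix (Fin d) (Fin d) ℝ} (hA : A.det ≠ 0) (m : Fin d → ℤ) :
    a • (Aᵀ *ᵥ dualPoint a A m) = fun i => (m i : ℝ) := by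
  rw [dualPoint, Matrix.mulVec_smul, smul_smul, mul_inv_cancel₀ ha, one_smul, Matrix.mulVec_mulVec,
    ← Matrix.transpose_mul, Matrix.nonsing_inv_mul A (isUnit_iff_ne_zero.2 hA),
    Matrix.transpose_one, Matrix.one_mulVec]

theorem dualPoint_injective {d : ℕ} {a : ℝ} (ha : a ≠ 0) {A : Matrix (Fin d) (Fin d) ℝ}
    (hA : A.det ≠ 0) : Function.Injective (dualPoint a A) := by
  intro m m' h
  have h1 := smul_transpose_mulVec_dualPoint ha hA m
  rw [h, smul_transpose_mulVec_dualPoint ha hA m'] at h1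
  funext i
  exact_mod_cast (congrFun h1 i).symm

theorem sum_frolovNodes {d : ℕ} {a : ℝ} (ha : a ≠ 0) {A : Matrix (Fin d) (Fin d) ℝ}
    (hA : A.det ≠ 0) (g : (Fin d → ℝ) → ℝ)
    (hg : ∀ x, (¬ ∀ j, x j ∈ Set.Ico (-1 / 2 : ℝ) (3 / 2)) → g x = 0) :
    ∑ η : frolovNodes a A, g η.1 = ∑' m, g (dualPoint a A m) := by
  choose ι hι using fun η : frolovNodes a A => η.2.1
  have hι' : ∀ η, dualPoint a A (ι η) = η.1 := fun η => (hι η).symm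
  have hinj : Function.Injective ι := fun η η' h => Subtype.ext (by rw [← hι', ← hι', h])
  rw [← tsum_fintype (L := .unconditional _), ← hinj.tsum_eq (f := fun m => g (dualPoint a A m))]
  · simp only [hι']
  · intro m hm
    have hbox : ∀ j, dualPoint a A m j ∈ Set.Ico (-1 / 2 : ℝ) (3 / 2) := by
      by_contra h
      exact hm (hg _ h)
    refine ⟨⟨dualPoint a A m, ⟨m, rfl⟩, hbox⟩, dualPoint_injective ha hA ?_⟩
    rw [hι']

/-- Integer vectors with entries at most K ≈ a/(2β) in absolute value have dual points in [-1/2,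
1/2]^d, and there are (2K + 1)^d of them. -/
theorem exists_le_frolovCard {d : ℕ} {A : Matrix (Fin d) (Fin d) ℝ} (hA : A.det ≠ 0) :
    ∃ c : ℝ, 0 < c ∧ ∀ a : ℝ, 1 < a → (c * a) ^ d ≤ frolovCard a A := by
  set β : ℝ := 1 + ∑ i, ∑ k, |(A⁻¹)ᵀ i k| with hβ
  have hβ0 : 0 ≤ ∑ i, ∑ k, |(A⁻¹)ᵀ i k| :=
    Finset.sum_nonneg fun _ _ => Finset.sum_nonneg fun _ _ => abs_nonneg _
  have hβ1 : 0 < β := by linarith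
  refine ⟨1 / (2 * β), by positivity, fun a ha => ?_⟩
  have ha0 : 0 < a := by linarith
  set K := ⌊1 / (2 * β) * a⌋₊ with hK
  have hKle : (K : ℝ) ≤ 1 / (2 * β) * a := Nat.floor_le (by positivity)
  have hKlt : 1 / (2 * β) * a < K + 1 := Nat.lt_floor_add_one _
  have hmem : ∀ m : Fin d → Fin (2 * K + 1),
      dualPoint a A (fun i => (m i : ℤ) - K) ∈ frolovNodes a A := by
    refine fun m => ⟨⟨_, rfl⟩, fun j => ?_⟩
    have h1 : ∀ i, |(((m i : ℤ) - K : ℤ) : ℝ)| ≤ K := fun i => by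
      have := (m i).2
      have : |(m i : ℤ) - K| ≤ K := by rw [abs_le]; omega
      exact_mod_cast this
    have h2 := abs_mulVec_le (A⁻¹)ᵀ (Nat.cast_nonneg K) h1 j
    have h3 : |dualPoint a A (fun i => (m i : ℤ) - K) j| ≤ 1 / 2 := by
      rw [dualPoint, Pi.smul_apply, smul_eq_mul, abs_mul, abs_of_pos (inv_pos.2 ha0),
        inv_mul_le_iff₀ ha0]
      refine h2.trans ?_
      calc (∑ i, ∑ k, |(A⁻¹)ᵀ i k|) * (K : ℝ) ≤ β * (1 / (2 * β) * a) :=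
            mul_le_mul (by linarith) hKle (by positivity) hβ1.le
        _ = a * (1 / 2) := by field_simp
    rw [abs_le] at h3
    constructor <;> linarith [h3.1, h3.2]
  have hinj : Function.Injective fun m : Fin d → Fin (2 * K + 1) =>
      (⟨_, hmem m⟩ : frolovNodes a A) := by
    intro m m' h
    have h1 := dualPoint_injective ha0.ne' hA (Subtype.ext_iff.1 h)
    funext i
    have h2 := congrFun h1 i
    simp only [sub_left_inj] at h2
    exact Fin.ext (by exact_mod_cast h2)
  have hcard := Fintype.card_le_of_injective _ hinj
  rw [Fintype.card_fun, Fintype.card_fin, Fintype.card_fin] at hcard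
  calc (1 / (2 * β) * a) ^ d ≤ (2 * K + 1 : ℝ) ^ d := by
        refine pow_le_pow_left₀ (by positivity) ?_ d
        have : (0 : ℝ) ≤ K := Nat.cast_nonneg K
        linarith
    _ ≤ frolovCard a A := by exact_mod_cast hcard

theorem exists_frolovCard_le {d : ℕ} {A : Matrix (Fin d) (Fin d) ℝ} (hA : A.det ≠ 0) :
    ∃ c : ℝ, 0 < c ∧ ∀ a : ℝ, 1 < a → (frolovCard a A : ℝ) ≤ (c * a) ^ d := by
  set α : ℝ := ∑ i, ∑ k, |Aᵀ i k| with hα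
  have hα0 : 0 ≤ α := Finset.sum_nonneg fun _ _ => Finset.sum_nonneg fun _ _ => abs_nonneg _
  refine ⟨3 * α + 3, by positivity, fun a ha => ?_⟩
  have ha0 : 0 < a := by linarith
  set K := ⌈a * (α * (3 / 2))⌉₊ with hK
  have hK1 : a * (α * (3 / 2)) ≤ K := Nat.le_ceil _
  have hK2 : (K : ℝ) < a * (α * (3 / 2)) + 1 := Nat.ceil_lt_add_one (by positivity)
  choose ι hι using fun η : frolovNodes a A => η.2.1
  have hι' : ∀ η, dualPoint a A (ι η) = η.1 := fun η => (hι η).symm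
  have hinj : Function.Injective ι := fun η η' h => Subtype.ext (by rw [← hι', ← hι', h])
  have hmem : ∀ η ∈ (Finset.univ : Finset (frolovNodes a A)),
      ι η ∈ Fintype.piFinset fun _ : Fin d => Finset.Icc (-(K : ℤ)) K := by
    intro η _
    rw [Fintype.mem_piFinset]
    intro i
    have h1 := congrFun (smul_transpose_mulVec_dualPoint ha0.ne' hA (ι η)) i
    rw [hι', Pi.smul_apply, smul_eq_mul] at h1
    have h2 : |(ι η i : ℝ)| ≤ K := by
      rw [← h1, abs_mul, abs_of_pos ha0]
      refine le_trans (mul_le_mul_of_nonneg_left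
        (abs_mulVec_le Aᵀ (by norm_num) (fun k => ?_) i) ha0.le) hK1
      have := η.2.2 k
      rw [abs_le]
      constructor <;> linarith [this.1, this.2]
    have h3 : |ι η i| ≤ (K : ℤ) := by exact_mod_cast h2
    exact Finset.mem_Icc.2 (abs_le.1 h3)
  have hcard := Finset.card_le_card_of_injOn ι hmem hinj.injOn
  rw [Fintype.card_piFinset, Finset.card_univ] at hcard
  have hIcc : (Finset.Icc (-(K : ℤ)) K).card = 2 * K + 1 := by
    rw [Int.card_Icc]; omega
  simp only [hIcc, Finset.prod_const, Finset.card_univ, Fintype.card_fin] at hcard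
  calc (frolovCard a A : ℝ) ≤ (2 * K + 1 : ℝ) ^ d := by exact_mod_cast hcard
    _ ≤ _ := pow_le_pow_left₀ (by positivity) (by nlinarith) d

/-! ### Poisson summation -/

theorem exists_finset_eq_zero {d : ℕ} {G : (Fin d → ℝ) → ℂ} {ρ : ℝ}
    (hG : ∀ x, G x ≠ 0 → ∀ i, |x i| ≤ ρ) (R : ℝ) :
    ∃ s : Finset (Fin d → ℤ), ∀ x : Fin d → ℝ, (∀ i, |x i| ≤ R) → ∀ m ∉ s,
      G (fun i => x i + m i) = 0 := by
  obtain ⟨K, hK⟩ : ∃ K : ℤ, R + ρ ≤ K := ⟨⌈R + ρ⌉, Int.le_ceil _⟩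
  refine ⟨Fintype.piFinset fun _ => Finset.Icc (-K) K, fun x hx m hm => ?_⟩
  by_contra h
  refine hm (Fintype.mem_piFinset.2 fun i => Finset.mem_Icc.2 (abs_le.1 ?_))
  have h1 : |(m i : ℝ)| ≤ K := by
    have e : (m i : ℝ) = (x i + m i) - x i := by ring
    rw [e]
    refine (abs_sub _ _).trans ?_
    linarith [hG _ h i, hx i]
  exact_mod_cast h1

theorem continuous_tsum_translates {d : ℕ} {G : (Fin d → ℝ) → ℂ} (hc : Continuous G) {ρ : ℝ}
    (hG : ∀ x, G x ≠ 0 → ∀ i, |x i| ≤ ρ) :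
    Continuous fun x : Fin d → ℝ => ∑' m : Fin d → ℤ, G fun i => x i + m i := by
  rw [continuous_iff_continuousAt]
  intro x₀
  obtain ⟨s, hs⟩ := exists_finset_eq_zero hG (‖x₀‖ + 1)
  have hev : (fun x : Fin d → ℝ => ∑' m : Fin d → ℤ, G fun i => x i + m i) =ᶠ[nhds x₀]
      fun x => ∑ m ∈ s, G fun i => x i + m i := by
    filter_upwards [Metric.ball_mem_nhds x₀ one_pos] with x hx
    refine tsum_eq_sum fun m hm => hs x (fun i => ?_) m hm
    have h1 : ‖x‖ ≤ ‖x₀‖ + 1 := by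
      rw [mem_ball_iff_norm] at hx
      linarith [norm_le_norm_add_norm_sub' x x₀]
    exact (norm_le_pi_norm x i).trans h1
  refine ContinuousAt.congr ?_ hev.symm
  exact Continuous.continuousAt (by fun_prop)

/-- Unfolding: the unit cubes with integer corners tile the space, and each is translated back to
the one at the origin. -/
theorem integral_eq_tsum_cubes {d : ℕ} {H : (Fin d → ℝ) → ℂ} (hH : Integrable H) :
    ∫ x, H x = ∑' m : Fin d → ℤ,
      ∫ x in {x : Fin d → ℝ | ∀ i, x i ∈ Set.Ioc (0 : ℝ) (0 + 1)}, H fun i => x i + m i := by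
  set Q := {x : Fin d → ℝ | ∀ i, x i ∈ Set.Ioc (0 : ℝ) (0 + 1)} with hQ
  set s : (Fin d → ℤ) → Set (Fin d → ℝ) := fun m => (fun x i => x i - (m i : ℝ)) ⁻¹' Q with hs
  have hQm : MeasurableSet Q := MeasurableSet.univ_pi' fun i => measurableSet_Ioc
  have hsm : ∀ m, MeasurableSet (s m) := fun m =>
    hQm.preimage (by fun_prop)
  have hdisj : Pairwise (Function.onFun Disjoint s) := by
    intro m m' hne
    refine Set.disjoint_left.2 fun x hx hx' => hne ?_
    funext i
    have h1 := hx i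
    have h2 := hx' i
    have ha : (m i : ℝ) < m' i + 1 := by linarith [h1.1, h2.2]
    have hb : (m' i : ℝ) < m i + 1 := by linarith [h2.1, h1.2]
    have ha' : m i < m' i + 1 := by exact_mod_cast ha
    have hb' : m' i < m i + 1 := by exact_mod_cast hb
    omega
  have hun : ⋃ m, s m = Set.univ := by
    refine Set.eq_univ_of_forall fun x => Set.mem_iUnion.2 ⟨fun i => ⌈x i⌉ - 1, fun i => ?_⟩
    have h1 := Int.ceil_lt_add_one (x i)
    have h2 := Int.le_ceil (x i)
    push_cast
    constructor <;> linarith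
  have h0 : ∫ x, H x = ∫ x in ⋃ m, s m, H x := by rw [hun, setIntegral_univ]
  rw [h0, integral_iUnion hsm hdisj hH.integrableOn]
  refine tsum_congr fun m => ?_
  have hmp : MeasurePreserving (fun (x : Fin d → ℝ) i => x i - (m i : ℝ)) volume volume :=
    measurePreserving_sub_right volume fun i => (m i : ℝ)
  have hme : MeasurableEmbedding (fun (x : Fin d → ℝ) i => x i - (m i : ℝ)) :=
    (MeasurableEquiv.subRight fun i => (m i : ℝ)).measurableEmbedding
  rw [← hmp.setIntegral_preimage_emb hme (fun x => H fun i => x i + m i) Q]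
  refine setIntegral_congr_fun (hsm m) fun x _ => ?_
  simp

open UnitAddTorus in
/-- Poisson summation on `ℝ^d` for a continuous function of bounded support with summable Fourier
transform. -/
theorem tsum_eq_tsum_integral_mFourier {d : ℕ} {G : (Fin d → ℝ) → ℂ} (hc : Continuous G) {ρ : ℝ}
    (hG : ∀ x, G x ≠ 0 → ∀ i, |x i| ≤ ρ)
    (hs : Summable fun n : Fin d → ℤ => ∫ x : Fin d → ℝ, mFourier (-n) (fun i => x i) * G x) :
    ∑' m : Fin d → ℤ, G (fun i => m i) =
      ∑' n : Fin d → ℤ, ∫ x : Fin d → ℝ, mFourier (-n) (fun i => x i) * G x := by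
  set P : (Fin d → ℝ) → ℂ := fun x => ∑' m : Fin d → ℤ, G fun i => x i + m i with hP
  have hPc : Continuous P := continuous_tsum_translates hc hG
  let π : C(Fin d → ℝ, UnitAddTorus (Fin d)) :=
    ⟨fun x i => (x i : UnitAddCircle), continuous_pi fun i =>
      (AddCircle.continuous_mk' 1).comp (continuous_apply i)⟩
  -- A product of open quotient maps is one, so the continuous periodization P descends to a
  -- continuous function on the torus.
  have hπ : Topology.IsQuotientMap π :=
    (IsOpenQuotientMap.piMap fun _ : Fin d =>
      (QuotientAddGroup.isOpenQuotientMap_mk :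
        IsOpenQuotientMap (fun x : ℝ => (x : UnitAddCircle)))).isQuotientMap
  have hper : ∀ (m : Fin d → ℤ) x, P (fun i => x i + m i) = P x := by
    intro m x
    simp only [hP]
    rw [← (Equiv.addLeft m).tsum_eq fun n : Fin d → ℤ => G fun i => x i + n i]
    refine tsum_congr fun n => ?_
    congr 1
    funext i
    simp only [Equiv.coe_addLeft, Pi.add_apply]
    push_cast
    ring
  have hfac : ∀ x y, π x = π y → P x = P y := by
    intro x y hxy
    have h1 : ∀ i, ∃ k : ℤ, x i = y i + k := by
      intro i
      have h2 : ((x i : ℝ) : UnitAddCircle) = y i := congrFun hxy i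
      obtain ⟨k, hk⟩ := AddSubgroup.mem_zmultiples_iff.1 (QuotientAddGroup.eq_iff_sub_mem.1 h2)
      refine ⟨k, ?_⟩
      rw [zsmul_eq_mul, mul_one] at hk
      linarith
    choose m hm using h1
    rw [← hper m y]
    congr 1
    funext i
    exact hm i
  let F : C(UnitAddTorus (Fin d), ℂ) := hπ.lift ⟨P, hPc⟩ hfac
  have hF : ∀ x : Fin d → ℝ, F (fun i => (x i : UnitAddCircle)) = P x := fun x =>
    DFunLike.congr_fun (hπ.lift_comp ⟨P, hPc⟩ hfac) x
  have hcoeff : ∀ n, mFourierCoeff F n =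
      ∫ x : Fin d → ℝ, mFourier (-n) (fun i => x i) * G x := by
    intro n
    set H : (Fin d → ℝ) → ℂ := fun x => mFourier (-n) (fun i => x i) * G x with hH
    have hHc : Continuous H :=
      (((mFourier (-n)).continuous.comp π.continuous)).mul hc
    have hH0 : ∀ x, H x ≠ 0 → ∀ i, |x i| ≤ ρ := fun x hx => hG x (right_ne_zero_of_mul hx)
    have hHcs : HasCompactSupport H := by
      refine HasCompactSupport.of_support_subset_isCompact
        (isCompact_univ_pi fun _ : Fin d => isCompact_Icc (a := -ρ) (b := ρ)) fun x hx i _ => ?_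
      exact abs_le.1 (hH0 x hx i)
    have hHi : Integrable H := hHc.integrable_of_hasCompactSupport hHcs
    -- Unfolding: the character is invariant under integer shifts, so the torus coefficient of P is
    -- the Fourier transform of G at n.
    rw [mFourierCoeff_eq_integral F n 0, integral_eq_tsum_cubes hHi]
    simp only [Pi.zero_apply]
    obtain ⟨s, hs⟩ := exists_finset_eq_zero hH0 1
    set Q := {x : Fin d → ℝ | ∀ i, x i ∈ Set.Ioc (0 : ℝ) (0 + 1)} with hQ
    have hQm : MeasurableSet Q := MeasurableSet.univ_pi' fun i => measurableSet_Ioc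
    have hQ1 : ∀ x ∈ Q, ∀ i, |x i| ≤ 1 := fun x hx i => by
      have := hx i
      rw [abs_le]; constructor <;> linarith [this.1, this.2]
    have hshift : ∀ (x : Fin d → ℝ) (m : Fin d → ℤ), H (fun i => x i + m i) =
        mFourier (-n) (fun i => x i) * G fun i => x i + m i := by
      intro x m
      simp only [hH]
      congr 2
      funext i
      simp
    have hint : ∀ m : Fin d → ℤ, IntegrableOn (fun x : Fin d → ℝ => H fun i => x i + m i) Q :=
      fun m => (hHi.comp_add_right fun i => (m i : ℝ)).integrableOn
    rw [tsum_eq_sum (s := s), ← integral_finsetSum _ fun m _ => hint m]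
    · refine setIntegral_congr_fun hQm fun x hx => ?_
      simp only [hF, smul_eq_mul, hP]
      rw [← tsum_mul_left, tsum_eq_sum (s := s)]
      · exact Finset.sum_congr rfl fun m _ => (hshift x m).symm
      · intro m hm
        rw [← hshift, hs x (hQ1 x hx) m hm]
    · intro m hm
      refine (setIntegral_congr_fun hQm fun x hx => hs x (hQ1 x hx) m hm).trans ?_
      simp
  have hsum : Summable (mFourierCoeff F) := by
    rw [show mFourierCoeff F = _ from funext hcoeff]; exact hs
  have hmain := (hasSum_mFourier_series_apply_of_summable hsum (fun i => ((0 : ℝ) : UnitAddCircle))).tsum_eq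
  rw [show F (fun i => ((0 : ℝ) : UnitAddCircle)) = P 0 from hF 0] at hmain
  simp only [hP, Pi.zero_apply, zero_add] at hmain
  rw [← hmain]
  refine tsum_congr fun n => ?_
  rw [hcoeff]
  simp [mFourier]

/-- The character `x ↦ e^{-2πiyx}`. -/
noncomputable def expNeg (y x : ℝ) : ℂ := Complex.exp (((-(2 * Real.pi * y * x) : ℝ) : ℂ) * Complex.I)

theorem prod_expNeg {d : ℕ} (y x : Fin d → ℝ) :
    ∏ j, expNeg (y j) (x j) =
      Complex.exp (((-(2 * Real.pi * (y ⬝ᵥ x)) : ℝ) : ℂ) * Complex.I) := by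
  simp only [expNeg]
  rw [← Complex.exp_sum, ← Finset.sum_mul]
  congr 2
  rw [dotProduct, Finset.mul_sum, ← Finset.sum_neg_distrib]
  push_cast
  exact Finset.sum_congr rfl fun j _ => by ring

theorem mFourier_neg_coe {d : ℕ} (n : Fin d → ℤ) (x : Fin d → ℝ) :
    UnitAddTorus.mFourier (-n) (fun i => (x i : UnitAddCircle)) =
      ∏ j, expNeg (n j) (x j) := by
  simp only [UnitAddTorus.mFourier, ContinuousMap.coe_mk]
  refine Finset.prod_congr rfl fun j _ => ?_
  rw [fourier_coe_apply, expNeg]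
  congr 1
  push_cast
  simp only [Pi.neg_apply]
  push_cast
  ring

/-- Poisson summation for the lattice `aA ℤ^d` and its dual. -/
theorem tsum_dualPoint {d : ℕ} {a : ℝ} (ha : 0 < a) {A : Matrix (Fin d) (Fin d) ℝ}
    (hA : A.det ≠ 0) {F : (Fin d → ℝ) → ℂ} (hc : Continuous F) {ρ : ℝ}
    (hF : ∀ x, F x ≠ 0 → ∀ i, |x i| ≤ ρ)
    (hs : Summable fun n : Fin d → ℤ => ∫ x : Fin d → ℝ,
      (∏ j, expNeg (a * (A *ᵥ fun i => (n i : ℝ)) j) (x j)) * F x) :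
    ((a ^ d * |A.det| : ℝ) : ℂ)⁻¹ * ∑' m : Fin d → ℤ, F (dualPoint a A m) =
      ∑' n : Fin d → ℤ, ∫ x : Fin d → ℝ,
        (∏ j, expNeg (a * (A *ᵥ fun i => (n i : ℝ)) j) (x j)) * F x := by
  -- The substitution x = B t carries ℤ^d to the scaled dual lattice, and the frequency n to a A n
  -- because n · t = (a A n) · (B t).
  set B : Matrix (Fin d) (Fin d) ℝ := a⁻¹ • (A⁻¹)ᵀ with hB
  have hdet : B.det = (a ^ d * A.det)⁻¹ := by
    rw [hB, Matrix.det_smul, Matrix.det_transpose, Matrix.det_nonsing_inv, Ring.inverse_eq_inv',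
      Fintype.card_fin, inv_pow, mul_inv]
  have hdet0 : B.det ≠ 0 := by
    rw [hdet]; exact inv_ne_zero (mul_ne_zero (pow_ne_zero _ ha.ne') hA)
  have hcoef : |(B.det)⁻¹| = a ^ d * |A.det| := by
    rw [hdet, inv_inv, abs_mul, abs_of_pos (pow_pos ha d)]
  have hAB : ∀ t : Fin d → ℝ, a • (Aᵀ *ᵥ (B *ᵥ t)) = t := by
    intro t
    rw [hB, Matrix.smul_mulVec, Matrix.mulVec_smul, smul_smul, mul_inv_cancel₀ ha.ne', one_smul,
      Matrix.mulVec_mulVec, ← Matrix.transpose_mul,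
      Matrix.nonsing_inv_mul A (isUnit_iff_ne_zero.2 hA), Matrix.transpose_one, Matrix.one_mulVec]
  have hBc : Continuous fun t : Fin d → ℝ => B *ᵥ t := by fun_prop
  set G : (Fin d → ℝ) → ℂ := fun t => F (B *ᵥ t) with hGdef
  have hG : ∀ t, G t ≠ 0 → ∀ i, |t i| ≤ a * ((∑ i, ∑ k, |Aᵀ i k|) * |ρ|) := by
    intro t ht i
    have h1 := abs_mulVec_le Aᵀ (abs_nonneg ρ)
      (fun i => (hF _ ht i).trans (le_abs_self ρ)) i
    have h2 : t i = a * (Aᵀ *ᵥ (B *ᵥ t)) i := (congrFun (hAB t) i).symm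
    rw [h2, abs_mul, abs_of_pos ha]
    exact mul_le_mul_of_nonneg_left h1 ha.le
  have hint : ∀ n : Fin d → ℤ,
      ∫ t : Fin d → ℝ, UnitAddTorus.mFourier (-n) (fun i => (t i : UnitAddCircle)) * G t =
      ((a ^ d * |A.det| : ℝ) : ℂ) * ∫ x : Fin d → ℝ,
        (∏ j, expNeg (a * (A *ᵥ fun i => (n i : ℝ)) j) (x j)) * F x := by
    intro n
    set Φ : (Fin d → ℝ) → ℂ := fun x =>
      (∏ j, expNeg (a * (A *ᵥ fun i => (n i : ℝ)) j) (x j)) * F x with hΦ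
    have hΦc : Continuous Φ := by
      simp only [hΦ, expNeg]; fun_prop
    have hmap := Real.map_matrix_volume_pi_eq_smul_volume_pi hdet0
    have h1 : ∫ x, Φ x ∂(Measure.map (Matrix.toLin' B) volume) = ∫ t, Φ (B *ᵥ t) := by
      rw [integral_map (by fun_prop) hΦc.aestronglyMeasurable]
      rfl
    rw [hmap, integral_smul_measure, ENNReal.toReal_ofReal (abs_nonneg _), hcoef] at h1
    rw [← Complex.real_smul, h1]
    congr 1
    funext t
    rw [mFourier_neg_coe, hΦ]
    simp only [prod_expNeg, hGdef]
    congr 5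
    conv_lhs => rw [← hAB t]
    rw [dotProduct_smul, Matrix.mulVec_transpose, dotProduct_comm, ← Matrix.dotProduct_mulVec,
      dotProduct_comm, ← smul_dotProduct]
    rfl
  have hpos : ((a ^ d * |A.det| : ℝ) : ℂ) ≠ 0 :=
    Complex.ofReal_ne_zero.2 (mul_ne_zero (pow_ne_zero _ ha.ne') (abs_ne_zero.2 hA))
  have hP := tsum_eq_tsum_integral_mFourier (G := G) (hc.comp hBc) hG (by
    simp only [hint]; exact hs.mul_left _)
  simp only [hint, tsum_mul_left] at hP
  rw [inv_mul_eq_iff_eq_mul₀ hpos, ← hP]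
  refine tsum_congr fun m => ?_
  simp only [hGdef, dualPoint, hB, Matrix.smul_mulVec]

/-! ### Window averages and Fourier decay -/

/-- The integral of `g` over the interval of length `u` centred at `x`. -/
noncomputable def windowIntegral (u : ℝ) (g : ℝ → ℂ) (x : ℝ) : ℂ :=
  ∫ t in (x - u / 2)..(x + u / 2), g t

theorem hasDerivAt_windowIntegral (u : ℝ) {g g' : ℝ → ℂ} (hg : ∀ x, HasDerivAt g (g' x) x)
    (hg' : Continuous g') (x : ℝ) :
    HasDerivAt (windowIntegral u g) (windowIntegral u g' x) x := by
  have hc : Continuous g := continuous_iff_continuousAt.2 fun x => (hg x).continuousAt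
  have h1 : windowIntegral u g' x = g (x + u / 2) - g (x - u / 2) :=
    intervalIntegral.integral_eq_sub_of_hasDerivAt (fun t _ => hg t)
      (hg'.intervalIntegrable _ _)
  have h2 : windowIntegral u g =
      fun x => (∫ t in (0 : ℝ)..(x + u / 2), g t) - ∫ t in (0 : ℝ)..(x - u / 2), g t := by
    funext x
    rw [windowIntegral, intervalIntegral.integral_interval_sub_left] <;>
      exact hc.intervalIntegrable _ _
  rw [h1, h2]
  have h3 := ((hc.integral_hasStrictDerivAt 0 (x + u / 2)).hasDerivAt).comp_add_const x (u / 2)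
  have h4 := ((hc.integral_hasStrictDerivAt 0 (x - u / 2)).hasDerivAt).comp_sub_const x (u / 2)
  exact h3.sub h4

theorem continuous_windowIntegral (u : ℝ) {g : ℝ → ℂ} (hc : Continuous g) :
    Continuous (windowIntegral u g) := by
  have h2 : windowIntegral u g =
      fun x => (∫ t in (0 : ℝ)..(x + u / 2), g t) - ∫ t in (0 : ℝ)..(x - u / 2), g t := by
    funext x
    rw [windowIntegral, intervalIntegral.integral_interval_sub_left] <;>
      exact hc.intervalIntegrable _ _
  have h3 : Continuous fun b => ∫ t in (0 : ℝ)..b, g t :=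
    continuous_iff_continuousAt.2 fun b => (hc.integral_hasStrictDerivAt 0 b).hasDerivAt.continuousAt
  rw [h2]
  exact (h3.comp (by fun_prop)).sub (h3.comp (by fun_prop))

theorem continuous_iterate_windowIntegral (u : ℝ) {g : ℝ → ℂ} (hc : Continuous g) (r : ℕ) :
    Continuous ((windowIntegral u)^[r] g) := by
  induction r with
  | zero => exact hc
  | succ r ih => rw [Function.iterate_succ_apply']; exact continuous_windowIntegral u ih

theorem hasDerivAt_iterate_windowIntegral (u : ℝ) {g g' : ℝ → ℂ}
    (hg : ∀ x, HasDerivAt g (g' x) x) (hg' : Continuous g') (r : ℕ) (x : ℝ) :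
    HasDerivAt ((windowIntegral u)^[r] g) ((windowIntegral u)^[r] g' x) x := by
  induction r generalizing x with
  | zero => exact hg x
  | succ r ih =>
    simp only [Function.iterate_succ_apply']
    exact hasDerivAt_windowIntegral u ih (continuous_iterate_windowIntegral u hg' r) x

theorem iterate_windowIntegral_add_const_mul (u : ℝ) {f g : ℝ → ℂ} (hf : Continuous f)
    (hg : Continuous g) (c : ℂ) (r : ℕ) :
    (windowIntegral u)^[r] (fun x => f x + c * g x) =
      fun x => (windowIntegral u)^[r] f x + c * (windowIntegral u)^[r] g x := by
  induction r with
  | zero => rfl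
  | succ r ih =>
    rw [Function.iterate_succ_apply', ih, Function.iterate_succ_apply',
      Function.iterate_succ_apply']
    funext x
    have h1 := continuous_iterate_windowIntegral u hf r
    have h2 := continuous_iterate_windowIntegral u hg r
    have h3 : Continuous fun t => c * (windowIntegral u)^[r] g t := continuous_const.mul h2
    rw [windowIntegral, intervalIntegral.integral_add (h1.intervalIntegrable _ _)
      (h3.intervalIntegrable _ _), intervalIntegral.integral_const_mul]
    rfl

theorem norm_windowIntegral_le {u : ℝ} (hu : 0 < u) {g : ℝ → ℂ} {C : ℝ} (hg : ∀ x, ‖g x‖ ≤ C)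
    (x : ℝ) : ‖windowIntegral u g x‖ ≤ C * u := by
  refine (intervalIntegral.norm_integral_le_of_norm_le_const fun t _ => hg t).trans ?_
  rw [show x + u / 2 - (x - u / 2) = u by ring, abs_of_pos hu]

theorem norm_expNeg (y x : ℝ) : ‖expNeg y x‖ = 1 := Complex.norm_exp_ofReal_mul_I _

theorem continuous_expNeg (y : ℝ) : Continuous (expNeg y) := by
  unfold expNeg; fun_prop

theorem hasDerivAt_expNeg (y x : ℝ) :
    HasDerivAt (expNeg y) (-(2 * Real.pi * y * Complex.I) * expNeg y x) x := by
  have h1 : HasDerivAt (fun x : ℝ => -(2 * Real.pi * y * x)) (-(2 * Real.pi * y)) x := by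
    convert! ((hasDerivAt_id x).const_mul (2 * Real.pi * y)).neg using 1
    simp
  have h2 := ((h1.ofReal_comp).mul_const Complex.I).cexp
  unfold expNeg
  convert! h2 using 1
  push_cast
  ring

/-- Decay of the iterated window integrals of a modulated bump function. -/
theorem exists_norm_iterate_windowIntegral_le (r : ℕ) : ∀ ψ : ℝ → ℝ, ContDiff ℝ (⊤ : ℕ∞) ψ →
    HasCompactSupport ψ → ∃ C : ℝ, 0 ≤ C ∧ ∀ u : ℝ, 0 < u → u ≤ 1 → ∀ y z : ℝ,
      ‖(windowIntegral u)^[r] (fun x => (ψ x : ℂ) * expNeg y x) z‖ ≤ C * ((max u⁻¹ |y|)⁻¹) ^ r := by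
  induction r with
  | zero =>
    intro ψ hψ hψc
    obtain ⟨C, hC⟩ := hψc.exists_bound_of_continuous hψ.continuous
    refine ⟨C, (norm_nonneg _).trans (hC 0), fun u _ _ y z => ?_⟩
    simpa [norm_expNeg] using hC z
  | succ r ih =>
    intro ψ hψ hψc
    have hψd : ContDiff ℝ (⊤ : ℕ∞) (deriv ψ) := by
      have := (contDiff_infty_iff_deriv (f := ψ)).1 hψ
      exact this.2
    obtain ⟨C₀, hC₀, h₀⟩ := ih ψ hψ hψc
    -- The induction hypothesis is also needed for the derivative of ψ, which is why ψ is quantified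
    -- inside the induction.
    obtain ⟨C₁, hC₁, h₁⟩ := ih (deriv ψ) hψd hψc.deriv
    refine ⟨2 * C₀ + C₁, by positivity, fun u hu hu1 y z => ?_⟩
    set w := (max u⁻¹ |y|)⁻¹ with hw
    have hmax : 0 < max u⁻¹ |y| := lt_max_of_lt_left (inv_pos.2 hu)
    have hw0 : 0 < w := inv_pos.2 hmax
    set g : ℝ → ℂ := fun x => (ψ x : ℂ) * expNeg y x with hg
    set g₁ : ℝ → ℂ := fun x => ((deriv ψ x : ℝ) : ℂ) * expNeg y x with hg₁
    have hgc : Continuous g :=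
      (Complex.continuous_ofReal.comp hψ.continuous).mul (continuous_expNeg y)
    have hg₁c : Continuous g₁ :=
      (Complex.continuous_ofReal.comp hψd.continuous).mul (continuous_expNeg y)
    set c : ℂ := -(2 * Real.pi * y * Complex.I) with hc
    have hder : ∀ x, HasDerivAt g (g₁ x + c * g x) x := by
      intro x
      have h := ((hψ.differentiable (by simp) x).hasDerivAt.ofReal_comp).mul (hasDerivAt_expNeg y x)
      convert! h using 1
      simp only [hg, hg₁, hc]; ring
    set h := (windowIntegral u)^[r] g with hh
    set h' := (windowIntegral u)^[r] g₁ with hh'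
    have hhc : Continuous h := continuous_iterate_windowIntegral u hgc r
    have hhc' : Continuous h' := continuous_iterate_windowIntegral u hg₁c r
    have hchc : Continuous fun x => c * h x := continuous_const.mul hhc
    have hder' : ∀ x, HasDerivAt h (h' x + c * h x) x := by
      intro x
      have := hasDerivAt_iterate_windowIntegral u hder (hg₁c.add (continuous_const.mul hgc)) r x
      rwa [iterate_windowIntegral_add_const_mul u hg₁c hgc] at this
    -- Integrating the derivative of h over one window: the frequency c times the new average is
    -- bounded by terms of the previous order. This gives the gain 1/|y|; the length of the window
    -- alone gives the gain u.
    have hftc : windowIntegral u h' z + c * windowIntegral u h z =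
        h (z + u / 2) - h (z - u / 2) := by
      rw [← intervalIntegral.integral_eq_sub_of_hasDerivAt (fun t _ => hder' t)
        ((hhc'.add hchc).intervalIntegrable _ _),
        intervalIntegral.integral_add (hhc'.intervalIntegrable _ _)
        (hchc.intervalIntegrable _ _), intervalIntegral.integral_const_mul]
      rfl
    have hb1 : ‖windowIntegral u h z‖ ≤ C₀ * w ^ r * u :=
      norm_windowIntegral_le hu (fun x => h₀ u hu hu1 y x) z
    have hb2 : ‖windowIntegral u h' z‖ ≤ C₁ * w ^ r * u :=
      norm_windowIntegral_le hu (fun x => h₁ u hu hu1 y x) z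
    have hcn : |y| ≤ ‖c‖ := by
      rw [hc, norm_neg]
      simp only [norm_mul, Complex.norm_I, mul_one, Complex.norm_real, Real.norm_eq_abs,
        Complex.norm_ofNat]
      rw [abs_of_pos Real.pi_pos]
      nlinarith [Real.pi_gt_three, abs_nonneg y]
    have hb3 : |y| * ‖windowIntegral u h z‖ ≤ (2 * C₀ + C₁) * w ^ r := by
      have e : c * windowIntegral u h z = h (z + u / 2) - h (z - u / 2) - windowIntegral u h' z := by
        rw [← hftc]; ring
      calc |y| * ‖windowIntegral u h z‖ ≤ ‖c‖ * ‖windowIntegral u h z‖ := by gcongr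
        _ = ‖h (z + u / 2) - h (z - u / 2) - windowIntegral u h' z‖ := by rw [← norm_mul, e]
        _ ≤ ‖h (z + u / 2)‖ + ‖h (z - u / 2)‖ + ‖windowIntegral u h' z‖ :=
          (norm_sub_le _ _).trans (add_le_add_left (norm_sub_le _ _) _)
        _ ≤ C₀ * w ^ r + C₀ * w ^ r + C₁ * w ^ r * 1 := by
          gcongr
          · exact h₀ u hu hu1 y _
          · exact h₀ u hu hu1 y _
          · exact hb2.trans (by gcongr)
        _ = _ := by ring
    have hb4 : u⁻¹ * ‖windowIntegral u h z‖ ≤ (2 * C₀ + C₁) * w ^ r := by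
      calc u⁻¹ * ‖windowIntegral u h z‖ ≤ u⁻¹ * (C₀ * w ^ r * u) := by gcongr
        _ = C₀ * w ^ r := by field_simp
        _ ≤ _ := by gcongr; linarith
    rw [Function.iterate_succ_apply', pow_succ, ← mul_assoc, hw, ← div_eq_mul_inv, le_div_iff₀ hmax,
      mul_comm, max_mul_of_nonneg _ _ (norm_nonneg _)]
    exact max_le hb4 hb3

/-! ### Convolution structure of the functions h^r -/

theorem hat_one (x u : ℝ) :
    hat 1 x u = Set.indicator (Set.Ico (-u / 2) (u / 2)) (fun _ => (1 : ℝ)) x := by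
  rw [hat]

theorem hat_add_two (r : ℕ) (x u : ℝ) :
    hat (r + 2) x u = ∫ y : ℝ, hat (r + 1) (x - y) u * hat 1 y u := by
  rw [hat]; simp only [hat_one]

theorem integral_mul_hat_one {E : Type*} [NormedRing E] [NormedSpace ℝ E] [IsScalarTower ℝ E E]
    [SMulCommClass ℝ E E] (f : ℝ → E) {u : ℝ} (hu : 0 < u) :
    ∫ y, hat 1 y u • f y = ∫ y in (-u / 2)..(u / 2), f y := by
  rw [intervalIntegral.integral_of_le (by linarith), ← integral_Ico_eq_integral_Ioc,
    ← integral_indicator measurableSet_Ico]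
  congr 1
  funext y
  rw [hat_one]
  by_cases h : y ∈ Set.Ico (-u / 2) (u / 2) <;> simp [h]

theorem integrable_hat (r : ℕ) (u : ℝ) : Integrable fun x => hat (r + 1) x u := by
  induction r with
  | zero =>
    simp only [zero_add, hat_one]
    exact (integrable_indicator_iff measurableSet_Ico).2 (by simp)
  | succ r ih =>
    have h1 : Integrable fun x => hat 1 x u := by
      simp only [hat_one]
      exact (integrable_indicator_iff measurableSet_Ico).2 (by simp)
    have h := h1.integrable_convolution (ContinuousLinearMap.mul ℝ ℝ) ih
    refine h.congr (Filter.Eventually.of_forall fun x => ?_)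
    simp only [convolution, ContinuousLinearMap.mul_apply', hat_add_two, mul_comm]

theorem abs_le_of_hat_ne_zero (r : ℕ) {x u : ℝ} (hu : 0 < u) (h : hat (r + 1) x u ≠ 0) :
    |x| ≤ (r + 1) * u := by
  induction r generalizing x with
  | zero =>
    rw [zero_add, hat_one] at h
    have := Set.mem_of_indicator_ne_zero h
    rw [abs_le]
    push_cast
    constructor <;> linarith [this.1, this.2]
  | succ r ih =>
    rw [hat_add_two] at h
    obtain ⟨y, hy⟩ : ∃ y, hat (r + 1) (x - y) u * hat 1 y u ≠ 0 := by
      by_contra! hcon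
      exact h (by simp [hcon])
    have h1 := ih (left_ne_zero_of_mul hy)
    have h2 := right_ne_zero_of_mul hy
    rw [hat_one] at h2
    have h3 := Set.mem_of_indicator_ne_zero h2
    rw [abs_le] at h1 ⊢
    push_cast
    constructor <;> linarith [h3.1, h3.2, h1.1, h1.2]

theorem continuous_hat (r : ℕ) {u : ℝ} (hu : 0 < u) : Continuous fun x => hat (r + 2) x u := by
  have hint := integrable_hat r u
  have h : (fun x => hat (r + 2) x u) = fun x => (∫ t in (0 : ℝ)..(x + u / 2), hat (r + 1) t u) -
      ∫ t in (0 : ℝ)..(x - u / 2), hat (r + 1) t u := by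
    funext x
    rw [intervalIntegral.integral_interval_sub_left hint.intervalIntegrable hint.intervalIntegrable,
      hat_add_two]
    have h1 := integral_mul_hat_one (fun y => hat (r + 1) (x - y) u) hu
    simp only [smul_eq_mul, mul_comm (hat 1 _ u)] at h1
    rw [h1, intervalIntegral.integral_comp_sub_left (fun y => hat (r + 1) y u)]
    congr 1; ring
  have h3 : Continuous fun b => ∫ t in (0 : ℝ)..b, hat (r + 1) t u :=
    intervalIntegral.continuous_primitive (fun _ _ => hint.intervalIntegrable) 0
  rw [h]
  exact (h3.comp (by fun_prop)).sub (h3.comp (by fun_prop))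

/-- By Fubini each convolution factor h^1 becomes one window integral, so the decay estimate for
iterated window integrals applies to pairings with h^r. -/
theorem integral_mul_hat {u : ℝ} (hu : 0 < u) {g : ℝ → ℂ} (hg : Continuous g) {C : ℝ}
    (hC : ∀ x, ‖g x‖ ≤ C) (r : ℕ) (z : ℝ) :
    ∫ x, g x * (hat (r + 1) (x - z) u : ℂ) = (windowIntegral u)^[r + 1] g z := by
  induction r generalizing z with
  | zero =>
    rw [zero_add, Function.iterate_one, windowIntegral,
      ← integral_add_right_eq_self _ z]
    have h := integral_mul_hat_one (fun y => g (y + z)) hu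
    simp only [add_sub_cancel_right]
    simp only [Complex.real_smul, mul_comm _ (g _)] at h
    rw [h, intervalIntegral.integral_comp_add_right]
    congr 1 <;> ring
  | succ r ih =>
    have h1 : Integrable fun x => hat 1 x u := integrable_hat 0 u
    have h2 : Integrable fun x => hat (r + 1) (x - z) u := (integrable_hat r u).comp_sub_right z
    have h3 := h1.convolution_integrand (ContinuousLinearMap.mul ℝ ℝ) h2
    have h4 : Integrable (fun p : ℝ × ℝ =>
        g p.1 * ((hat 1 p.2 u * hat (r + 1) (p.1 - p.2 - z) u : ℝ) : ℂ)) (volume.prod volume) := by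
      refine Integrable.bdd_mul (c := C) h3.ofReal ?_ (Filter.Eventually.of_forall fun p => hC p.1)
      exact (hg.comp continuous_fst).aestronglyMeasurable
    calc ∫ x, g x * (hat (r + 1 + 1) (x - z) u : ℂ)
        = ∫ x, ∫ y, g x * ((hat 1 y u * hat (r + 1) (x - y - z) u : ℝ) : ℂ) := by
          congr 1; funext x
          rw [integral_const_mul, integral_complex_ofReal, hat_add_two]
          congr 3; funext y
          rw [mul_comm, sub_right_comm]
      _ = ∫ y, ∫ x, g x * ((hat 1 y u * hat (r + 1) (x - y - z) u : ℝ) : ℂ) :=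
          integral_integral_swap h4
      _ = ∫ y, hat 1 y u • (windowIntegral u)^[r + 1] g (y + z) := by
          congr 1; funext y
          rw [← ih (y + z), Complex.real_smul, ← integral_const_mul]
          congr 1; funext x
          push_cast
          rw [sub_sub]; ring
      _ = (windowIntegral u)^[r + 1 + 1] g z := by
          rw [integral_mul_hat_one _ hu, Function.iterate_succ_apply' _ (r + 1), windowIntegral,
            intervalIntegral.integral_comp_add_right]
          congr 1 <;> ring

/-! ### Localization of the periodic functions -/

/-- A smooth function supported in `[-1/2, 3/2]` whose integer translates sum to `1`. -/
noncomputable def bump (x : ℝ) : ℝ :=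
  Real.smoothTransition (x + 1 / 2) - Real.smoothTransition (x - 1 / 2)

theorem contDiff_bump : ContDiff ℝ (⊤ : ℕ∞) bump := by
  unfold bump
  exact (Real.smoothTransition.contDiff.comp (by fun_prop)).sub
    (Real.smoothTransition.contDiff.comp (by fun_prop))

theorem bump_eq_zero {x : ℝ} (hx : x ∉ Set.Ioo (-1 / 2 : ℝ) (3 / 2)) : bump x = 0 := by
  rw [bump]
  rcases le_or_gt x (-1 / 2) with h | h
  · rw [Real.smoothTransition.zero_of_nonpos (by linarith),
      Real.smoothTransition.zero_of_nonpos (by linarith), sub_zero]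
  · have h' : 3 / 2 ≤ x := by
      by_contra! h'
      exact hx ⟨h, h'⟩
    rw [Real.smoothTransition.one_of_one_le (by linarith),
      Real.smoothTransition.one_of_one_le (by linarith), sub_self]

theorem hasCompactSupport_bump : HasCompactSupport bump :=
  HasCompactSupport.of_support_subset_isCompact (isCompact_Icc (a := -1 / 2) (b := 3 / 2))
    fun x hx => Set.Ioo_subset_Icc_self (by
      by_contra h
      exact hx (bump_eq_zero h))

/-- Shifting the second transition by one period makes the two transitions cancel except over [1/2,
3/2], where the first is identically 1. -/
theorem integral_bump_mul {p : ℝ → ℝ} (hp : Continuous p) (hper : Function.Periodic p 1) :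
    ∫ x, bump x * p x = ∫ x in (0 : ℝ)..1, p x := by
  have hS := Real.smoothTransition.continuous
  set S := Real.smoothTransition with hSdef
  have c1 : Continuous fun x => S (x + 1 / 2) * p x := (hS.comp (by fun_prop)).mul hp
  have c2 : Continuous fun x => S (x - 1 / 2) * p x := (hS.comp (by fun_prop)).mul hp
  have h1 : ∫ x, bump x * p x = ∫ x in (-1 / 2 : ℝ)..(3 / 2), bump x * p x := by
    refine (intervalIntegral.integral_eq_integral_of_support_subset fun x hx => ?_).symm
    have : x ∈ Set.Ioo (-1 / 2 : ℝ) (3 / 2) := by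
      by_contra h
      exact hx (by simp only [bump_eq_zero h, zero_mul])
    exact Set.Ioo_subset_Ioc_self this
  have h2 : ∫ x in (-1 / 2 : ℝ)..(3 / 2), bump x * p x =
      (∫ x in (-1 / 2 : ℝ)..(3 / 2), S (x + 1 / 2) * p x) -
        ∫ x in (-1 / 2 : ℝ)..(3 / 2), S (x - 1 / 2) * p x := by
    rw [← intervalIntegral.integral_sub (c1.intervalIntegrable _ _) (c2.intervalIntegrable _ _)]
    congr 1; funext x; rw [bump]; ring
  have h3 : ∫ x in (-1 / 2 : ℝ)..(3 / 2), S (x - 1 / 2) * p x =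
      ∫ x in (-1 / 2 : ℝ)..(1 / 2), S (x + 1 / 2) * p x := by
    rw [← intervalIntegral.integral_add_adjacent_intervals (b := 1 / 2)
      (c2.intervalIntegrable _ _) (c2.intervalIntegrable _ _)]
    have e1 : ∫ x in (-1 / 2 : ℝ)..(1 / 2), S (x - 1 / 2) * p x = 0 := by
      rw [intervalIntegral.integral_congr (g := fun _ => (0 : ℝ))]
      · simp
      · intro x hx
        rw [Set.uIcc_of_le (by norm_num)] at hx
        show S (x - 1 / 2) * p x = 0
        rw [hSdef, Real.smoothTransition.zero_of_nonpos (by linarith [hx.2]), zero_mul]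
    rw [e1, zero_add]
    have e2 := intervalIntegral.integral_comp_add_right (a := -1 / 2) (b := 1 / 2)
      (fun x => S (x - 1 / 2) * p x) 1
    rw [show (-1 / 2 + 1 : ℝ) = 1 / 2 by norm_num, show (1 / 2 + 1 : ℝ) = 3 / 2 by norm_num] at e2
    rw [← e2]
    congr 1; funext x
    rw [hper x, show x + 1 - 1 / 2 = x + 1 / 2 by ring]
  have h4 : ∫ x in (1 / 2 : ℝ)..(3 / 2), S (x + 1 / 2) * p x = ∫ x in (1 / 2 : ℝ)..(3 / 2), p x := by
    refine intervalIntegral.integral_congr fun x hx => ?_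
    rw [Set.uIcc_of_le (by norm_num)] at hx
    show S (x + 1 / 2) * p x = p x
    rw [hSdef, Real.smoothTransition.one_of_one_le (by linarith [hx.1]), one_mul]
  rw [h1, h2, h3, ← intervalIntegral.integral_add_adjacent_intervals (a := -1 / 2) (b := 1 / 2)
      (c1.intervalIntegrable _ _) (c1.intervalIntegrable _ _), h4]
  have h5 := hper.intervalIntegral_add_eq (1 / 2) 0
  rw [show (1 / 2 + 1 : ℝ) = 3 / 2 by norm_num, zero_add] at h5
  rw [h5]; ring

/-- The `1`-periodization of `hat r · u`. -/
noncomputable def perHatOne (r : ℕ) (x u : ℝ) : ℝ := ∑' k : ℤ, hat r (k + x) u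

theorem hat_int_add_eq_zero {r : ℕ} {u : ℝ} (hu : 0 < u) (hu1 : u ≤ 1) {x R : ℝ} {K : ℤ}
    (hK : r + 1 + R ≤ K) (hx : |x| ≤ R) {k : ℤ} (hk : k ∉ Finset.Icc (-K) K) :
    hat (r + 1) (k + x) u = 0 := by
  by_contra h
  have h1 := abs_le_of_hat_ne_zero r hu h
  refine hk (Finset.mem_Icc.2 (abs_le.1 ?_))
  have h2 : |(k : ℝ)| ≤ K := by
    have e : (k : ℝ) = (k + x) - x := by ring
    rw [e]
    refine (abs_sub _ _).trans ?_
    have : (r + 1) * u ≤ (r + 1 : ℝ) * 1 := by gcongr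
    linarith
  exact_mod_cast h2

theorem perHatOne_eq_sum {r : ℕ} {u : ℝ} (hu : 0 < u) (hu1 : u ≤ 1) {x R : ℝ} {K : ℤ}
    (hK : r + 1 + R ≤ K) (hx : |x| ≤ R) :
    perHatOne (r + 1) x u = ∑ k ∈ Finset.Icc (-K) K, hat (r + 1) (k + x) u :=
  tsum_eq_sum fun _ hk => hat_int_add_eq_zero hu hu1 hK hx hk

theorem periodic_perHatOne (r : ℕ) (u : ℝ) : Function.Periodic (fun x => perHatOne r x u) 1 := by
  intro x
  simp only [perHatOne]
  rw [← (Equiv.addRight (1 : ℤ)).tsum_eq fun k : ℤ => hat r (k + x) u]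
  refine tsum_congr fun k => ?_
  congr 1
  simp only [Equiv.coe_addRight]
  push_cast
  ring

theorem continuous_perHatOne (r : ℕ) {u : ℝ} (hu : 0 < u) (hu1 : u ≤ 1) :
    Continuous fun x => perHatOne (r + 2) x u := by
  rw [continuous_iff_continuousAt]
  intro x₀
  obtain ⟨K, hK⟩ : ∃ K : ℤ, ((r + 1 : ℕ) : ℝ) + 1 + (|x₀| + 1) ≤ K := ⟨_, Int.le_ceil _⟩
  have hev : (fun x => perHatOne (r + 2) x u) =ᶠ[nhds x₀]
      fun x => ∑ k ∈ Finset.Icc (-K) K, hat (r + 2) (k + x) u := by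
    filter_upwards [Metric.ball_mem_nhds x₀ one_pos] with x hx
    refine perHatOne_eq_sum hu hu1 hK ?_
    rw [Metric.mem_ball, Real.dist_eq] at hx
    linarith [abs_sub_abs_le_abs_sub x x₀]
  refine ContinuousAt.congr ?_ hev.symm
  have := continuous_hat r hu
  exact (continuous_finsetSum _ fun k _ => this.comp (by fun_prop)).continuousAt

/-- The Fourier transform of `bump · perHatOne`. -/
noncomputable def localFourier (r : ℕ) (z u y : ℝ) : ℂ :=
  ∫ x, expNeg y x * ((bump x * perHatOne r (x - z) u : ℝ) : ℂ)

theorem exists_norm_localFourier_le (r : ℕ) : ∃ C : ℝ, 0 ≤ C ∧ ∀ u : ℝ, 0 < u → u ≤ 1 → ∀ z : ℝ,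
    z ∈ Set.Ico (0 : ℝ) 1 → ∀ y,
    ‖localFourier (r + 2) z u y‖ ≤ C * ((max u⁻¹ |y|)⁻¹) ^ (r + 2) := by
  obtain ⟨C, hC, h⟩ := exists_norm_iterate_windowIntegral_le (r + 2) bump contDiff_bump
    hasCompactSupport_bump
  -- On the support of the bump |x - z| ≤ 2, and the support of h^(r+2) lies within r + 2 of 0, so
  -- translates with |k| > r + 4 vanish there.
  set K : ℤ := r + 4 with hKdef
  refine ⟨(Finset.Icc (-K) K).card * C, by positivity, fun u hu hu1 z hz y => ?_⟩
  have hK : ((r + 1 : ℕ) : ℝ) + 1 + 2 ≤ K := by rw [hKdef]; push_cast; linarith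
  set g : ℝ → ℂ := fun x => (bump x : ℂ) * expNeg y x with hg
  have hgc : Continuous g :=
    (Complex.continuous_ofReal.comp contDiff_bump.continuous).mul (continuous_expNeg y)
  obtain ⟨D, hD⟩ := hasCompactSupport_bump.exists_bound_of_continuous contDiff_bump.continuous
  have hgD : ∀ x, ‖g x‖ ≤ D := fun x => by simpa [hg, norm_expNeg] using hD x
  have hpt : ∀ x, expNeg y x * ((bump x * perHatOne (r + 2) (x - z) u : ℝ) : ℂ) =
      ∑ k ∈ Finset.Icc (-K) K, g x * (hat (r + 2) (x - (z - k)) u : ℂ) := by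
    intro x
    by_cases hx : x ∈ Set.Ioo (-1 / 2 : ℝ) (3 / 2)
    · rw [perHatOne_eq_sum hu hu1 hK (by
        rw [abs_le]; constructor <;> linarith [hx.1, hx.2, hz.1, hz.2]), ← Finset.mul_sum, hg]
      push_cast
      rw [mul_left_comm, mul_assoc]
      congr 2
      refine Finset.sum_congr rfl fun k _ => ?_
      congr 2; ring
    · simp [hg, bump_eq_zero hx]
  have hint : ∀ k ∈ Finset.Icc (-K) K,
      Integrable fun x => g x * (hat (r + 2) (x - (z - k)) u : ℂ) := fun k _ =>
    Integrable.bdd_mul (c := D) ((integrable_hat (r + 1) u).comp_sub_right _).ofReal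
      hgc.aestronglyMeasurable (Filter.Eventually.of_forall hgD)
  simp only [localFourier, hpt]
  rw [integral_finsetSum _ hint, mul_assoc, ← nsmul_eq_mul]
  refine (norm_sum_le _ _).trans (Finset.sum_le_card_nsmul _ _ _ fun k _ => ?_)
  rw [integral_mul_hat hu hgc hgD]
  exact h u hu hu1 y _

theorem localFourier_zero (r : ℕ) {u : ℝ} (hu : 0 < u) (hu1 : u ≤ 1) (z : ℝ) :
    localFourier (r + 2) z u 0 = ((∫ x in (0 : ℝ)..1, perHatOne (r + 2) (x - z) u : ℝ) : ℂ) := by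
  have hper : Function.Periodic (fun x => perHatOne (r + 2) (x - z) u) 1 := fun x => by
    simpa [add_sub_right_comm] using periodic_perHatOne (r + 2) u (x - z)
  have hcont : Continuous fun x => perHatOne (r + 2) (x - z) u :=
    (continuous_perHatOne r hu hu1).comp (by fun_prop)
  rw [← integral_bump_mul hcont hper, ← integral_complex_ofReal, localFourier]
  congr 1; funext x
  simp [expNeg]

theorem perHat_eq_prod {d : ℕ} (r : ℕ) (x z : Fin d → ℝ) {u : Fin d → ℝ} (hu : ∀ j, 0 < u j)
    (hu1 : ∀ j, u j ≤ 1) :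
    perHat (r + 1) x z u = ∏ j, perHatOne (r + 1) (x j - z j) (u j) := by
  obtain ⟨R, hR⟩ := (Set.finite_range fun j => |x j - z j|).bddAbove
  have hR' : ∀ j, |x j - z j| ≤ R := fun j => hR ⟨j, rfl⟩
  obtain ⟨K, hK⟩ : ∃ K : ℤ, (r : ℝ) + 1 + R ≤ K := ⟨_, Int.le_ceil _⟩
  simp only [fun j => perHatOne_eq_sum (hu j) (hu1 j) hK (hR' j)]
  rw [Finset.prod_univ_sum, perHat, periodize, tsum_eq_sum]
  · exact Finset.sum_congr rfl fun k _ => Finset.prod_congr rfl fun j _ => by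
      rw [add_sub_assoc]
  · intro k hk
    rw [Fintype.mem_piFinset] at hk
    push Not at hk
    obtain ⟨j, hj⟩ := hk
    refine Finset.prod_eq_zero (Finset.mem_univ j) ?_
    rw [add_sub_assoc]
    exact hat_int_add_eq_zero (hu j) (hu1 j) hK (hR' j) hj

theorem perHat_fract {d : ℕ} (r : ℕ) (x z : Fin d → ℝ) {u : Fin d → ℝ} (hu : ∀ j, 0 < u j)
    (hu1 : ∀ j, u j ≤ 1) :
    perHat (r + 1) (fun j => Int.fract (x j)) z u = perHat (r + 1) x z u := by
  rw [perHat_eq_prod r _ z hu hu1, perHat_eq_prod r _ z hu hu1]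
  refine Finset.prod_congr rfl fun j _ => ?_
  have h := (periodic_perHatOne (r + 1) (u j)).sub_zsmul_eq ⌊x j⌋ (x := x j - z j)
  rw [← h]
  congr 1
  rw [zsmul_eq_mul, mul_one, Int.fract]; ring

theorem setIntegral_unitCube_perHat {d : ℕ} (r : ℕ) (z : Fin d → ℝ) {u : Fin d → ℝ}
    (hu : ∀ j, 0 < u j) (hu1 : ∀ j, u j ≤ 1) :
    ∫ x in unitCube d, perHat (r + 1) x z u =
      ∏ j, ∫ x in (0 : ℝ)..1, perHatOne (r + 1) (x - z j) (u j) := by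
  have hcube : unitCube d = Set.univ.pi fun _ => Set.Ico (0 : ℝ) 1 := by
    ext x; simp [unitCube]
  simp only [fun x => perHat_eq_prod r x z hu hu1]
  rw [hcube, volume_pi, Measure.restrict_pi_pi,
    integral_fintype_prod_eq_prod (fun j x => perHatOne (r + 1) (x - z j) (u j))]
  refine Finset.prod_congr rfl fun j _ => ?_
  rw [intervalIntegral.integral_of_le zero_le_one, integral_Ico_eq_integral_Ioc]

/-! ### The sum over the Frolov lattice -/

theorem card_filter_sum_eq_le {e : ℕ} (I : Finset (Fin (e + 1) → ℕ)) (N : ℕ) :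
    (I.filter fun s => ∑ j, s j = N).card ≤ (N + 1) ^ e := by
  have hmem : ∀ s ∈ I.filter (fun s => ∑ j, s j = N),
      Fin.tail s ∈ Fintype.piFinset fun _ : Fin e => Finset.range (N + 1) := by
    intro s hs
    have h := (Finset.mem_filter.1 hs).2
    refine Fintype.mem_piFinset.2 fun i => Finset.mem_range.2 (Nat.lt_succ_of_le ?_)
    rw [← h]
    exact Finset.single_le_sum (f := s) (fun _ _ => Nat.zero_le _) (Finset.mem_univ i.succ)
  have hinj : Set.InjOn Fin.tail (I.filter (fun s => ∑ j, s j = N) : Set (Fin (e + 1) → ℕ)) := by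
    intro s hs s' hs' h
    have h1 := (Finset.mem_filter.1 (Finset.mem_coe.1 hs)).2
    have h2 := (Finset.mem_filter.1 (Finset.mem_coe.1 hs')).2
    rw [Fin.sum_univ_succ] at h1 h2
    have h3 : ∀ i : Fin e, s i.succ = s' i.succ := fun i => congrFun h i
    simp only [h3] at h1
    funext j
    refine Fin.cases (by omega) h3 j
  refine (Finset.card_le_card_of_injOn Fin.tail hmem hinj).trans ?_
  simp [Fintype.card_piFinset]

theorem summable_succ_pow_mul_half_pow (e : ℕ) :
    Summable fun k : ℕ => ((k : ℝ) + 1) ^ e * (1 / 2) ^ k := by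
  have h := summable_pow_mul_geometric_of_norm_lt_one (R := ℝ) e (r := 1 / 2) (by norm_num)
  have h1 := ((summable_nat_add_iff 1).2 h).mul_left 2
  refine h1.congr fun k => ?_
  push_cast
  ring

/-- At most (N + 1)^e vectors have sum N = n₀ + k, and n₀ + k + 1 ≤ (n₀ + 1)(k + 1) separates the
factor in n₀ from a convergent series in k. -/
theorem exists_sum_two_pow_le (e : ℕ) : ∃ K : ℝ, 0 < K ∧ ∀ (I : Finset (Fin (e + 1) → ℕ)) (n₀ : ℕ),
    (∀ s ∈ I, n₀ ≤ ∑ j, s j) →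
    ∑ s ∈ I, (2 : ℝ) ^ n₀ / 2 ^ (∑ j, s j) ≤ K * ((n₀ : ℝ) + 1) ^ e := by
  set f : ℕ → ℝ := fun k => ((k : ℝ) + 1) ^ e * (1 / 2) ^ k with hf
  have hfs : Summable f := summable_succ_pow_mul_half_pow e
  have hf0 : ∀ k, 0 ≤ f k := fun k => by positivity
  refine ⟨∑' k, f k, hfs.tsum_pos hf0 0 (by simp [hf]), fun I n₀ hI => ?_⟩
  set J := I.image fun s => ∑ j, s j with hJ
  have hJn : ∀ N ∈ J, n₀ ≤ N := by
    intro N hN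
    obtain ⟨s, hs, rfl⟩ := Finset.mem_image.1 hN
    exact hI s hs
  rw [← Finset.sum_fiberwise_of_maps_to (t := J) (g := fun s : Fin (e + 1) → ℕ => ∑ j, s j)
    fun s hs => Finset.mem_image_of_mem _ hs]
  have hstep : ∀ N ∈ J, ∑ s ∈ I.filter (fun s => ∑ j, s j = N), (2 : ℝ) ^ n₀ / 2 ^ (∑ j, s j) ≤
      ((n₀ : ℝ) + 1) ^ e * f (N - n₀) := by
    intro N hN
    obtain ⟨k, rfl⟩ := Nat.exists_eq_add_of_le (hJn N hN)
    have h1 : ∀ s ∈ I.filter (fun s => ∑ j, s j = n₀ + k),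
        (2 : ℝ) ^ n₀ / 2 ^ (∑ j, s j) ≤ (1 / 2) ^ k := by
      intro s hs
      rw [(Finset.mem_filter.1 hs).2, pow_add, ← div_div, div_self (by positivity), one_div_pow]
    refine (Finset.sum_le_card_nsmul _ _ _ h1).trans ?_
    have h2 : ((I.filter fun s => ∑ j, s j = n₀ + k).card : ℝ) ≤ ((n₀ : ℝ) + k + 1) ^ e := by
      exact_mod_cast card_filter_sum_eq_le I (n₀ + k)
    rw [nsmul_eq_mul, Nat.add_sub_cancel_left, hf, ← mul_assoc, ← mul_pow]
    refine mul_le_mul_of_nonneg_right (h2.trans (pow_le_pow_left₀ (by positivity) ?_ e))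
      (by positivity)
    nlinarith [(Nat.cast_nonneg n₀ : (0 : ℝ) ≤ n₀), (Nat.cast_nonneg k : (0 : ℝ) ≤ k)]
  refine (Finset.sum_le_sum hstep).trans ?_
  rw [← Finset.mul_sum, mul_comm]
  refine mul_le_mul_of_nonneg_right ?_ (by positivity)
  rw [← Finset.sum_image (f := f) (g := fun N => N - n₀)]
  · exact hfs.sum_le_tsum _ fun k _ => hf0 k
  · intro N hN N' hN' h
    have a := hJn N hN
    have b := hJn N' hN'
    simp only at h
    omega

theorem exists_dyadic_level {B : ℝ} (hB : 0 < B) (y : ℝ) :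
    ∃ s : ℕ, |y| ≤ B * 2 ^ s ∧ B * 2 ^ s ≤ 2 * max B |y| := by
  have hex : ∃ s : ℕ, |y| ≤ B * 2 ^ s := by
    obtain ⟨s, hs⟩ := pow_unbounded_of_one_lt (|y| / B) (one_lt_two)
    exact ⟨s, by rw [div_lt_iff₀ hB] at hs; linarith⟩
  classical
  refine ⟨Nat.find hex, Nat.find_spec hex, ?_⟩
  rcases h : Nat.find hex with _ | k
  · have := le_max_left B |y|
    simp only [pow_zero, mul_one]
    linarith
  · have h1 := Nat.find_min hex (m := k) (by omega)
    have := le_max_right B |y|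
    rw [pow_succ]
    linarith

theorem IsFrolovMatrix.card_le_of_abs_le {d : ℕ} (hd : 1 ≤ d) {A : Matrix (Fin d) (Fin d) ℝ}
    (hA : IsFrolovMatrix A) {R : Fin d → ℝ} (hR : ∀ j, 0 < R j) (S : Finset (Fin d → ℤ))
    (hS : ∀ n ∈ S, ∀ j, |(A *ᵥ fun i => (n i : ℝ)) j| ≤ R j) :
    (S.card : ℝ) ≤ 2 ^ d * ∏ j, R j + 1 := by
  obtain ⟨hfin, hle⟩ := hA.card_le (fun j => -R j) R fun j => by linarith [hR j]
  have h1 := Set.ncard_le_ncard_of_injOn (s := (S : Set (Fin d → ℤ)))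
    (t := {y | y ∈ Set.Icc (fun j => -R j) R ∧ ∃ m : Fin d → ℤ, y = A *ᵥ fun i => (m i : ℝ)})
    (fun n : Fin d → ℤ => A *ᵥ fun i => (n i : ℝ))
    (fun n hn => ⟨⟨fun j => (abs_le.1 (hS n hn j)).1, fun j => (abs_le.1 (hS n hn j)).2⟩, n, rfl⟩)
    (hA.mulVec_injective hd).injOn hfin
  rw [Set.ncard_coe_finset] at h1
  have h2 : ∏ j, (R j - -R j) = 2 ^ d * ∏ j, R j := by
    simp only [sub_neg_eq_add, ← two_mul]
    rw [Finset.prod_mul_distrib]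
    simp
  rw [h2] at hle
  refine le_trans ?_ hle
  exact_mod_cast h1

theorem exists_sum_lattice_le {d : ℕ} (hd : 1 ≤ d) {r : ℕ} (hr : 2 ≤ r) :
    ∃ K : ℝ, 0 < K ∧ ∀ A : Matrix (Fin d) (Fin d) ℝ, IsFrolovMatrix A →
      ∀ B : Fin d → ℝ, (∀ j, 0 < B j) → ∀ S : Finset (Fin d → ℤ), 0 ∉ S →
      ∑ n ∈ S, ∏ j, ((max (B j) |(A *ᵥ fun i => (n i : ℝ)) j|)⁻¹) ^ r ≤
        K * ((⌈Real.logb 2 (∏ j, B j)⁻¹⌉₊ : ℝ) + 1) ^ (d - 1) := by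
  obtain ⟨e, rfl⟩ := Nat.exists_eq_add_of_le' hd
  obtain ⟨K, hK, hKsum⟩ := exists_sum_two_pow_le e
  set d := e + 1 with hde
  set M : ℝ := (2 ^ d + 1) * (2 ^ d) ^ r with hM
  refine ⟨M * K, by positivity, fun A hA B hB S hS => ?_⟩
  set P := ∏ j, B j with hP
  have hP0 : 0 < P := Finset.prod_pos fun j _ => hB j
  set n₀ := ⌈Real.logb 2 P⁻¹⌉₊ with hn₀
  have hT : P⁻¹ ≤ 2 ^ n₀ := by
    have := Nat.le_ceil (Real.logb 2 P⁻¹)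
    rw [Real.logb_le_iff_le_rpow one_lt_two (inv_pos.2 hP0), Real.rpow_natCast] at this
    exact this
  have hlev : ∀ (n : Fin d → ℤ) (j : Fin d), ∃ s : ℕ,
      |(A *ᵥ fun i => (n i : ℝ)) j| ≤ B j * 2 ^ s ∧
      B j * 2 ^ s ≤ 2 * max (B j) |(A *ᵥ fun i => (n i : ℝ)) j| := fun n j =>
    exists_dyadic_level (hB j) _
  choose σ hσ1 hσ2 using hlev
  have hprod : ∀ s : Fin d → ℕ, ∏ j, (B j * (2 : ℝ) ^ s j) = P * 2 ^ (∑ j, s j) := fun s => by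
    rw [Finset.prod_mul_distrib, Finset.prod_pow_eq_pow_sum]
  -- The product property forces every occupied dyadic box to have q = P · 2^(∑ s_j) ≥ 1, so all
  -- occurring s have sum at least n₀.
  have hbig : ∀ n ∈ S, 1 ≤ P * 2 ^ (∑ j, σ n j) := by
    intro n hn
    refine (hA.one_le_abs_prod n (ne_of_mem_of_not_mem hn hS)).trans ?_
    rw [Finset.abs_prod, ← hprod]
    exact Finset.prod_le_prod (fun _ _ => abs_nonneg _) fun j _ => hσ1 n j
  set I := S.image σ with hI
  have hI1 : ∀ s ∈ I, 1 ≤ P * 2 ^ (∑ j, s j) := by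
    intro s hs
    obtain ⟨n, hn, rfl⟩ := Finset.mem_image.1 hs
    exact hbig n hn
  have hIn : ∀ s ∈ I, n₀ ≤ ∑ j, s j := by
    intro s hs
    rw [hn₀, Nat.ceil_le, Real.logb_le_iff_le_rpow one_lt_two (inv_pos.2 hP0), Real.rpow_natCast,
      inv_le_iff_one_le_mul₀ hP0, mul_comm]
    exact hI1 s hs
  rw [← Finset.sum_fiberwise_of_maps_to (t := I) (g := σ) fun n hn => Finset.mem_image_of_mem _ hn]
  have hfib : ∀ s ∈ I, ∑ n ∈ S.filter (fun n => σ n = s),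
      ∏ j, ((max (B j) |(A *ᵥ fun i => (n i : ℝ)) j|)⁻¹) ^ r ≤
      M * ((2 : ℝ) ^ n₀ / 2 ^ (∑ j, s j)) := by
    intro s hs
    set q := P * 2 ^ (∑ j, s j) with hq
    have hq1 : 1 ≤ q := hI1 s hs
    have hq0 : 0 < q := by linarith
    have hterm : ∀ n ∈ S.filter (fun n => σ n = s),
        ∏ j, ((max (B j) |(A *ᵥ fun i => (n i : ℝ)) j|)⁻¹) ^ r ≤ (2 ^ d * q⁻¹) ^ r := by
      intro n hn
      obtain ⟨-, rfl⟩ := Finset.mem_filter.1 hn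
      rw [Finset.prod_pow]
      refine pow_le_pow_left₀ (Finset.prod_nonneg fun j _ =>
        inv_nonneg.2 ((hB j).le.trans (le_max_left _ _))) ?_ r
      calc ∏ j, (max (B j) |(A *ᵥ fun i => (n i : ℝ)) j|)⁻¹
          ≤ ∏ j, (2 * (B j * 2 ^ σ n j)⁻¹) := by
            refine Finset.prod_le_prod (fun j _ =>
              inv_nonneg.2 ((hB j).le.trans (le_max_left _ _))) fun j _ => ?_
            have h1 := hσ2 n j
            have h2 : 0 < B j * 2 ^ σ n j := mul_pos (hB j) (by positivity)
            rw [inv_le_comm₀ ((hB j).trans_le (le_max_left _ _)) (by positivity), mul_inv, inv_inv]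
            linarith
        _ = 2 ^ d * q⁻¹ := by
            rw [Finset.prod_mul_distrib, Finset.prod_inv_distrib, hprod]
            simp [hq, mul_comm]
    have hcard : ((S.filter fun n => σ n = s).card : ℝ) ≤ (2 ^ d + 1) * q := by
      have h := hA.card_le_of_abs_le hd (R := fun j => B j * 2 ^ s j)
        (fun j => mul_pos (hB j) (by positivity)) (S.filter fun n => σ n = s) (by
          intro n hn j
          obtain ⟨-, rfl⟩ := Finset.mem_filter.1 hn
          exact hσ1 n j)
      rw [hprod] at h
      linarith
    refine (Finset.sum_le_card_nsmul _ _ _ hterm).trans ?_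
    rw [nsmul_eq_mul]
    calc ((S.filter fun n => σ n = s).card : ℝ) * (2 ^ d * q⁻¹) ^ r
        ≤ (2 ^ d + 1) * q * (2 ^ d * q⁻¹) ^ r := by gcongr
      _ = M * (q * (q⁻¹) ^ r) := by rw [hM, mul_pow]; ring
      _ ≤ M * q⁻¹ := by
        gcongr
        -- Here r ≥ 2 is essential: for r = 1 the boxes would contribute O(1) each, with no decay.
        calc q * (q⁻¹) ^ r ≤ q * (q⁻¹) ^ 2 := by
              have : q⁻¹ ≤ 1 := inv_le_one_of_one_le₀ hq1
              gcongr ?_ * ?_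
              exact pow_le_pow_of_le_one (by positivity) this hr
          _ = q⁻¹ := by field_simp
      _ ≤ M * ((2 : ℝ) ^ n₀ / 2 ^ (∑ j, s j)) := by
        gcongr
        rw [hq, mul_inv, div_eq_mul_inv]
        gcongr
  refine (Finset.sum_le_sum hfib).trans ?_
  rw [← Finset.mul_sum, mul_assoc M K]
  exact mul_le_mul_of_nonneg_left (hKsum I n₀ hIn) (by positivity)

/-! ### The cubature error -/

/-- The weights of the localized Frolov cubature formula. -/
noncomputable def frolovWeight {d : ℕ} (a : ℝ) (A : Matrix (Fin d) (Fin d) ℝ)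
    (η : frolovNodes a A) : ℝ := (a ^ d * |A.det|)⁻¹ * ∏ j, bump (η.1 j)

theorem integral_prod_localFourier {d : ℕ} (r : ℕ) (y z u : Fin d → ℝ) :
    ∫ x : Fin d → ℝ, (∏ j, expNeg (y j) (x j)) *
        ((∏ j, bump (x j) * perHatOne r (x j - z j) (u j) : ℝ) : ℂ) =
      ∏ j, localFourier r (z j) (u j) (y j) := by
  simp only [localFourier]
  rw [← integral_fintype_prod_volume_eq_prod
    (fun j x => expNeg (y j) x * ((bump x * perHatOne r (x - z j) (u j) : ℝ) : ℂ))]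
  congr 1; funext x
  rw [Complex.ofReal_prod, ← Finset.prod_mul_distrib]

theorem exists_norm_prod_localFourier_le (d r : ℕ) :
    ∃ C : ℝ, 0 < C ∧ ∀ a : ℝ, 1 < a → ∀ z ∈ unitCube d, ∀ u ∈ scales d, ∀ y : Fin d → ℝ,
      ‖∏ j, localFourier (r + 2) (z j) (u j) (a * y j)‖ ≤
        C * (a ^ ((r + 2) * d))⁻¹ * ∏ j, ((max (a * u j)⁻¹ |y j|)⁻¹) ^ (r + 2) := by
  obtain ⟨C, hC, h⟩ := exists_norm_localFourier_le r
  refine ⟨(C + 1) ^ d, by positivity, fun a ha z hz u hu y => ?_⟩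
  have ha0 : 0 < a := by linarith
  have hj : ∀ j, ‖localFourier (r + 2) (z j) (u j) (a * y j)‖ ≤
      (C + 1) * (a ^ (r + 2))⁻¹ * ((max (a * u j)⁻¹ |y j|)⁻¹) ^ (r + 2) := by
    intro j
    have huj := hu j
    -- Factoring a out of each maximum produces a^(-rd) and the thresholds B_j = 1/(a u_j), whose
    -- inverse product is a^d ∏ u_j.
    have hmax : max (u j)⁻¹ |a * y j| = a * max (a * u j)⁻¹ |y j| := by
      rw [mul_max_of_nonneg _ _ ha0.le, abs_mul, abs_of_pos ha0, mul_inv, mul_inv_cancel_left₀ ha0.ne']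
    refine (h (u j) huj.1 (by linarith [huj.2]) (z j) (hz j) (a * y j)).trans ?_
    rw [hmax, mul_inv, mul_pow, inv_pow a, ← mul_assoc]
    have : 0 < max (a * u j)⁻¹ |y j| := lt_max_of_lt_left (inv_pos.2 (mul_pos ha0 huj.1))
    gcongr
    linarith
  rw [norm_prod]
  refine (Finset.prod_le_prod (fun _ _ => norm_nonneg _) fun j _ => hj j).trans ?_
  rw [Finset.prod_mul_distrib, Finset.prod_mul_distrib]
  simp only [Finset.prod_const, Finset.card_univ, Fintype.card_fin]
  rw [inv_pow, ← pow_mul]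

/-- Poisson summation identifies the error with the sum over n ≠ 0. The natural-number ceiling is 0
when a^d ∏ u_j ≤ 1, so the bound covers arbitrarily small volumes as well. -/
theorem exists_cubatureError_le {d : ℕ} (hd : 1 ≤ d) (r : ℕ) :
    ∃ K : ℝ, 0 < K ∧ ∀ A : Matrix (Fin d) (Fin d) ℝ, IsFrolovMatrix A → ∀ a : ℝ, 1 < a →
      ∀ z ∈ unitCube d, ∀ u ∈ scales d,
      cubatureError (r + 2) (foldedFrolov a A) (frolovWeight a A) z u ≤
        K * (a ^ ((r + 2) * d))⁻¹ * ((⌈Real.logb 2 (a ^ d * ∏ j, u j)⌉₊ : ℝ) + 1) ^ (d - 1) := by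
  obtain ⟨C, hC, hCle⟩ := exists_norm_prod_localFourier_le d r
  obtain ⟨K, hK, hKle⟩ := exists_sum_lattice_le hd (r := r + 2) (by omega)
  refine ⟨C * K, by positivity, fun A hA a ha z hz u hu => ?_⟩
  have ha0 : 0 < a := by linarith
  have hdet := hA.det_ne_zero hd
  have hu0 : ∀ j, 0 < u j := fun j => (hu j).1
  have hu1 : ∀ j, u j ≤ 1 := fun j => by linarith [(hu j).2]
  set F : (Fin d → ℝ) → ℝ := fun x =>
    ∏ j, bump (x j) * perHatOne (r + 2) (x j - z j) (u j) with hF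
  have hFc : Continuous F := continuous_finsetProd _ fun j _ =>
    (contDiff_bump.continuous.comp (continuous_apply j)).mul
      ((continuous_perHatOne r (hu0 j) (hu1 j)).comp (by fun_prop))
  have hF0 : ∀ x, F x ≠ 0 → ∀ j, x j ∈ Set.Ioo (-1 / 2 : ℝ) (3 / 2) := by
    intro x hx j
    by_contra hj
    exact hx (Finset.prod_eq_zero (Finset.mem_univ j) (by rw [bump_eq_zero hj, zero_mul]))
  set Λ : (Fin d → ℤ) → ℂ := fun n =>
    ∏ j, localFourier (r + 2) (z j) (u j) (a * (A *ᵥ fun i => (n i : ℝ)) j) with hΛ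
  set X : ℝ := C * (a ^ ((r + 2) * d))⁻¹ *
    (K * ((⌈Real.logb 2 (a ^ d * ∏ j, u j)⌉₊ : ℝ) + 1) ^ (d - 1)) with hX
  have hprod : (∏ j, (a * u j)⁻¹)⁻¹ = a ^ d * ∏ j, u j := by
    rw [Finset.prod_inv_distrib, inv_inv, Finset.prod_mul_distrib]; simp
  have hpartial : ∀ S : Finset (Fin d → ℤ), 0 ∉ S → ∑ n ∈ S, ‖Λ n‖ ≤ X := by
    intro S hS
    have h1 := hKle A hA (fun j => (a * u j)⁻¹) (fun j => inv_pos.2 (mul_pos ha0 (hu0 j))) S hS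
    rw [hprod] at h1
    refine (Finset.sum_le_sum fun n _ => hCle a ha z hz u hu _).trans ?_
    rw [← Finset.mul_sum, hX]
    exact mul_le_mul_of_nonneg_left h1 (by positivity)
  have hX0 : 0 ≤ X := by positivity
  -- The zero frequency is the integral itself; removing it leaves exactly the error, and the
  -- uniform bound on partial sums also yields the summability that Poisson summation requires.
  set Λ' : (Fin d → ℤ) → ℂ := fun n => if n = 0 then 0 else Λ n with hΛ'
  have hpartial' : ∀ S : Finset (Fin d → ℤ), ∑ n ∈ S, ‖Λ' n‖ ≤ X := by
    intro S
    classical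
    have h1 : ∑ n ∈ S, ‖Λ' n‖ = ∑ n ∈ S.erase 0, ‖Λ n‖ := by
      rw [← Finset.sum_subset (Finset.erase_subset 0 S)]
      · exact Finset.sum_congr rfl fun n hn => by simp [hΛ', Finset.ne_of_mem_erase hn]
      · intro n hn hn'
        have : n = 0 := by
          by_contra h
          exact hn' (Finset.mem_erase.2 ⟨h, hn⟩)
        simp [hΛ', this]
    rw [h1]
    exact hpartial _ (Finset.notMem_erase 0 S)
  have hs' : Summable fun n => ‖Λ' n‖ :=
    summable_of_sum_le (fun _ => norm_nonneg _) hpartial'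
  have hb' : ‖∑' n, Λ' n‖ ≤ X :=
    (norm_tsum_le_tsum_norm hs').trans (hs'.tsum_le_of_sum_le hpartial')
  have hs : Summable Λ := by
    refine (hs'.of_norm.add ((hasSum_ite_eq 0 (Λ 0)).summable)).congr fun n => ?_
    by_cases hn : n = 0 <;> simp [hΛ', hn]
  have hsplit : ∑' n, Λ n = Λ 0 + ∑' n, Λ' n := hs.tsum_eq_add_tsum_ite 0
  have hΛ0 : Λ 0 = ((∫ x in unitCube d, perHat (r + 2) x z u : ℝ) : ℂ) := by
    rw [setIntegral_unitCube_perHat (r + 1) z hu0 hu1, hΛ]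
    push_cast
    refine Finset.prod_congr rfl fun j _ => ?_
    rw [← localFourier_zero r (hu0 j) (hu1 j)]
    congr 1
    have : (fun i => (((0 : Fin d → ℤ) i : ℤ) : ℝ)) = 0 := by funext i; simp
    rw [this, Matrix.mulVec_zero, Pi.zero_apply, mul_zero]
  have hquad : ∑ η, frolovWeight a A η * perHat (r + 2) (foldedFrolov a A η) z u =
      (a ^ d * |A.det|)⁻¹ * ∑' m, F (dualPoint a A m) := by
    rw [← sum_frolovNodes ha0.ne' hdet F, Finset.mul_sum]
    · refine Finset.sum_congr rfl fun η _ => ?_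
      rw [frolovWeight, mul_assoc, hF]
      simp only [Finset.prod_mul_distrib]
      rw [← perHat_eq_prod (r + 1) η.1 z hu0 hu1, ← perHat_fract (r + 1) η.1 z hu0 hu1]
      rfl
    · intro x hx
      by_contra h
      exact hx fun j => Set.Ioo_subset_Ico_self (hF0 x h j)
  have hFT : (fun n : Fin d → ℤ => ∫ x : Fin d → ℝ,
      (∏ j, expNeg (a * (A *ᵥ fun i => (n i : ℝ)) j) (x j)) * ((F x : ℝ) : ℂ)) = Λ := by
    funext n
    exact integral_prod_localFourier (r + 2) _ z u
  have hpoisson := tsum_dualPoint ha0 hdet (F := fun x => ((F x : ℝ) : ℂ)) (ρ := 3 / 2)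
    (Complex.continuous_ofReal.comp hFc) (fun x hx j => by
      have := hF0 x (by exact_mod_cast hx) j
      rw [abs_le]; constructor <;> linarith [this.1, this.2]) (by rw [hFT]; exact hs)
  rw [hFT, hsplit, hΛ0, ← Complex.ofReal_tsum, ← Complex.ofReal_inv, ← Complex.ofReal_mul,
    ← hquad] at hpoisson
  have herr : ∑' n, Λ' n =
      ((∑ η, frolovWeight a A η * perHat (r + 2) (foldedFrolov a A η) z u -
        ∫ x in unitCube d, perHat (r + 2) x z u : ℝ) : ℂ) := by
    rw [Complex.ofReal_sub, hpoisson]; ring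
  rw [herr, Complex.norm_real, Real.norm_eq_abs, abs_sub_comm] at hb'
  refine hb'.trans (le_of_eq ?_)
  rw [hX]; ring

/-! ### Discrepancy bounds in terms of v and m -/

theorem natCeil_logb_le {T : ℝ} (hT : 1 ≤ T) :
    (⌈Real.logb 2 T⌉₊ : ℝ) + 1 ≤ 2 / Real.log 2 * Real.log (2 * T) := by
  have hlog2 : 0 < Real.log 2 := Real.log_pos one_lt_two
  have h0 : 0 ≤ Real.log T := Real.log_nonneg hT
  have h1 : 0 ≤ Real.logb 2 T := Real.logb_nonneg one_lt_two hT
  have h2 := Nat.ceil_lt_add_one h1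
  have h3 : 2 / Real.log 2 * Real.log (2 * T) = 2 + 2 * Real.logb 2 T := by
    rw [Real.log_mul (by norm_num) (by linarith), Real.logb]; field_simp
  linarith

theorem exists_fixedVolumeDiscrepancy_le {d : ℕ} (hd : 1 ≤ d) {r : ℕ} (hr : 2 ≤ r) :
    ∃ C : ℝ, 0 < C ∧ ∀ A : Matrix (Fin d) (Fin d) ℝ, IsFrolovMatrix A → ∀ a : ℝ, 1 < a → ∀ v : ℝ,
      (a ^ d)⁻¹ ≤ v → fixedVolumeDiscrepancy r (foldedFrolov a A) v ≤
        ENNReal.ofReal (C * (a ^ (r * d))⁻¹ * (Real.log (2 * v / (a ^ d)⁻¹)) ^ (d - 1)) := by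
  obtain ⟨r, rfl⟩ := Nat.exists_eq_add_of_le' hr
  obtain ⟨K, hK, h⟩ := exists_cubatureError_le hd r
  have hlog2 : 0 < Real.log 2 := Real.log_pos one_lt_two
  refine ⟨K * (2 / Real.log 2) ^ (d - 1), by positivity, fun A hA a ha v hv => ?_⟩
  have had : 0 < a ^ d := by positivity
  refine iInf_le_of_le (frolovWeight a A) (iSup₂_le fun z hz => iSup₂_le fun u hu =>
    ENNReal.ofReal_le_ofReal ((h A hA a ha z hz u hu.1).trans ?_))
  rw [hu.2]
  have hT : 1 ≤ a ^ d * v := by rwa [inv_le_iff_one_le_mul₀' had] at hv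
  calc K * (a ^ ((r + 2) * d))⁻¹ * ((⌈Real.logb 2 (a ^ d * v)⌉₊ : ℝ) + 1) ^ (d - 1)
      ≤ K * (a ^ ((r + 2) * d))⁻¹ *
          (2 / Real.log 2 * Real.log (2 * (a ^ d * v))) ^ (d - 1) := by
        gcongr
        exact natCeil_logb_le hT
    _ = _ := by
        rw [mul_pow, div_inv_eq_mul, show 2 * (a ^ d * v) = 2 * v * a ^ d by ring]; ring

theorem exists_log_le_log_card {d : ℕ} (hd : 1 ≤ d) {c : ℝ} (hc : 0 < c) :
    ∃ L : ℝ, 0 < L ∧ ∀ a : ℝ, 1 < a → ∀ m : ℕ, 2 ≤ m → (c * a) ^ d ≤ m →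
      Real.log (2 * a ^ d) ≤ L * Real.log m := by
  have hlog2 : 0 < Real.log 2 := Real.log_pos one_lt_two
  refine ⟨1 + (Real.log 2 + d * |Real.log c|) / Real.log 2, by positivity, fun a ha m hm hle => ?_⟩
  have ha0 : 0 < a := by linarith
  have hm2 : Real.log 2 ≤ Real.log m := Real.log_le_log (by norm_num) (by exact_mod_cast hm)
  have h1 : d * (Real.log c + Real.log a) ≤ Real.log m := by
    have := Real.log_le_log (by positivity) hle
    rwa [Real.log_pow, Real.log_mul hc.ne' ha0.ne'] at this
  have h2 : Real.log (2 * a ^ d) = Real.log 2 + d * Real.log a := by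
    rw [Real.log_mul (by norm_num) (by positivity), Real.log_pow]
  have h3 : -(d * |Real.log c|) ≤ d * Real.log c := by
    rw [← mul_neg]
    exact mul_le_mul_of_nonneg_left (neg_abs_le _) (Nat.cast_nonneg d)
  have h4 : Real.log 2 + d * |Real.log c| ≤
      (Real.log 2 + d * |Real.log c|) / Real.log 2 * Real.log m := by
    rw [div_mul_eq_mul_div, le_div_iff₀ hlog2]
    exact mul_le_mul_of_nonneg_left hm2 (by positivity)
  rw [h2]
  linarith

/-- The upper bound on m converts a^(-rd) into m^(-r), the lower bound converts log(2 a^d) into log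
m, and m ≥ 2 absorbs the additive constants. -/
theorem exists_periodicDiscrepancy_le {d : ℕ} (hd : 1 ≤ d) {A : Matrix (Fin d) (Fin d) ℝ}
    (hA : IsFrolovMatrix A) {r : ℕ} (hr : 2 ≤ r) :
    ∃ C : ℝ, 0 < C ∧ ∀ a : ℝ, 1 < a → 2 ≤ frolovCard a A →
      periodicDiscrepancy r (foldedFrolov a A) ≤ ENNReal.ofReal
        (C * ((frolovCard a A : ℝ) ^ r)⁻¹ * (Real.log (frolovCard a A)) ^ (d - 1)) := by
  obtain ⟨r, rfl⟩ := Nat.exists_eq_add_of_le' hr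
  obtain ⟨K, hK, h⟩ := exists_cubatureError_le hd r
  obtain ⟨c₁, hc₁, hlow⟩ := exists_le_frolovCard (hA.det_ne_zero hd)
  obtain ⟨c₂, hc₂, hupp⟩ := exists_frolovCard_le (hA.det_ne_zero hd)
  obtain ⟨L, hL, hlog⟩ := exists_log_le_log_card hd hc₁
  have hlog2 : 0 < Real.log 2 := Real.log_pos one_lt_two
  refine ⟨K * c₂ ^ ((r + 2) * d) * (2 / Real.log 2 * L) ^ (d - 1), by positivity,
    fun a ha hm => ?_⟩
  have ha0 : 0 < a := by linarith
  have ha1 : 1 ≤ a ^ d := one_le_pow₀ ha.le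
  set m := frolovCard a A with hmdef
  have hm0 : (0 : ℝ) < m := by exact_mod_cast (by omega : 0 < m)
  refine iInf_le_of_le (frolovWeight a A) (iSup₂_le fun z hz => iSup₂_le fun u hu =>
    ENNReal.ofReal_le_ofReal ((h A hA a ha z hz u hu).trans ?_))
  have hu1 : ∏ j, u j ≤ 1 :=
    Finset.prod_le_one (fun j _ => (hu j).1.le) fun j _ => by linarith [(hu j).2]
  have hu0 : 0 < ∏ j, u j := Finset.prod_pos fun j _ => (hu j).1
  have hceil : (⌈Real.logb 2 (a ^ d * ∏ j, u j)⌉₊ : ℝ) + 1 ≤ 2 / Real.log 2 * L * Real.log m := by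
    have h1 : (⌈Real.logb 2 (a ^ d * ∏ j, u j)⌉₊ : ℝ) ≤ ⌈Real.logb 2 (a ^ d)⌉₊ := by
      refine Nat.cast_le.2 (Nat.ceil_mono ?_)
      exact Real.logb_le_logb_of_le one_lt_two (by positivity)
        (mul_le_of_le_one_right (by positivity) hu1)
    have h2 := natCeil_logb_le ha1
    have h3 := mul_le_mul_of_nonneg_left (hlog a ha m hm (hlow a ha))
      (by positivity : 0 ≤ 2 / Real.log 2)
    linarith
  have hpow : (a ^ ((r + 2) * d))⁻¹ ≤ c₂ ^ ((r + 2) * d) * ((m : ℝ) ^ (r + 2))⁻¹ := by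
    have h1 : (m : ℝ) ^ (r + 2) ≤ c₂ ^ ((r + 2) * d) * a ^ ((r + 2) * d) := by
      rw [← mul_pow, mul_comm (r + 2) d, pow_mul]
      exact pow_le_pow_left₀ hm0.le (hupp a ha) _
    rw [← div_eq_mul_inv, le_div_iff₀ (by positivity), inv_mul_le_iff₀ (by positivity)]
    linarith
  calc K * (a ^ ((r + 2) * d))⁻¹ * ((⌈Real.logb 2 (a ^ d * ∏ j, u j)⌉₊ : ℝ) + 1) ^ (d - 1)
      ≤ K * (c₂ ^ ((r + 2) * d) * ((m : ℝ) ^ (r + 2))⁻¹) *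
          (2 / Real.log 2 * L * Real.log m) ^ (d - 1) := by gcongr
    _ = _ := by rw [mul_pow (2 / Real.log 2 * L)]; ring

end FrolovPeriodic

theorem corollary1p2 (d : ℕ) (hd : 2 ≤ d) :
    (∃ A : Matrix (Fin d) (Fin d) ℝ, FrolovPeriodic.IsFrolovMatrix A) ∧
    ∀ A : Matrix (Fin d) (Fin d) ℝ, FrolovPeriodic.IsFrolovMatrix A → ∀ r : ℕ, 2 ≤ r →
      (∃ c : ℝ, 0 < c ∧ ∃ C : ℝ, 0 < C ∧ ∀ a : ℝ, 1 < a → ∀ v : ℝ, c * (a ^ d)⁻¹ ≤ v →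
        FrolovPeriodic.fixedVolumeDiscrepancy r (FrolovPeriodic.foldedFrolov a A) v ≤
          ENNReal.ofReal
            (C * (a ^ (r * d))⁻¹ * (Real.log (2 * v / (c * (a ^ d)⁻¹))) ^ (d - 1))) ∧
      (∃ C : ℝ, 0 < C ∧ ∀ a : ℝ, 1 < a → 2 ≤ FrolovPeriodic.frolovCard a A →
        FrolovPeriodic.periodicDiscrepancy r (FrolovPeriodic.foldedFrolov a A) ≤
          ENNReal.ofReal
            (C * ((FrolovPeriodic.frolovCard a A : ℝ) ^ r)⁻¹ *
              (Real.log (FrolovPeriodic.frolovCard a A)) ^ (d - 1))) := by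
  have hd1 : 1 ≤ d := by omega
  refine ⟨FrolovPeriodic.exists_isFrolovMatrix hd1, fun A hA r hr => ⟨?_,
    FrolovPeriodic.exists_periodicDiscrepancy_le hd1 hA hr⟩⟩
  obtain ⟨C, hC, h⟩ := FrolovPeriodic.exists_fixedVolumeDiscrepancy_le hd1 hr
  -- The choice c = 1 makes v ≥ v₀ mean a^d v ≥ 1, where the ceiling is bounded by a multiple of
  -- log(2 a^d v).
  refine ⟨1, one_pos, C, hC, fun a ha v hv => ?_⟩
  rw [one_mul] at hv ⊢
  exact h A hA a ha v hv
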